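/- Let $m$ be Lebesgue measure on the unit disk $\mathbb D$, normalized so that $m(\mathbb D)=1$. Let $a,b\in\mathbb R$ satisfy either $a>1$, or $a=1$ and $b\le 1$, and let $$d\mu(a,b)(z)=\frac{dm(z)}{(1-|z|^2)^a\,\log^b\!\bigl(\frac{e}{1-|z|^2}\bigr)},\qquad z\in\mathbb D .$$ Let $\Lambda=\{\lambda_k\}_{k\ge1}$ be a Poisson point process in $\mathbb D$ with intensity $\mu=\mu(a,b)$: a random sequence in $\mathbb D$ such that for every Borel set $A\subset\mathbb D$ the number $N_A$ of points of $\Lambda$ in $A$ is a Poisson random variable of mean $\mu(A)$ (almost surely infinite if $\mu(A)=\infty$), and such that $N_{A_1},N_{A_2},\dots$ are independent whenever $A_1,A_2,\dots$ are pairwise disjoint Borel sets. A finite or infinite sequence of points is called separated if there is $\delta>0$ with $\bigl|\frac{\lambda_k-\lambda_l}{1-\overline{\lambda_l}\lambda_k}\bigr|\ge\delta$ for all $k\ne l$. For $\alpha\in(0,1]$, a sequence in $\mathbb D$ is called $\alpha$-Carleson if there is $C>0$ such that for all arcs $I$ of the unit circle $$\sum_{\lambda_k\in Q(I)}(1-|\lambda_k|)^\alpha\le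 C|I|^\alpha ,\qquad Q(I)=\{re^{i\theta}\in\mathbb D: r>1-|I|,\ e^{i\theta}\in I\},$$ where $|I|$ is the length of $I$ divided by $2\pi$. Then: (a) For every integer $M\ge1$, $\Lambda$ is almost surely a union of $M$ separated sequences if and only if either $a<2-\frac1{M+1}$, or $a=2-\frac1{M+1}$ and $b>\frac1{M+1}$. (b) In particular, $\Lambda$ is almost surely separated if and only if either $a<\frac32$, or $a=\frac32$ and $b>\frac12$. (c) $\Lambda$ is almost surely $1$-Carleson if and only if $a<2$. (d) For every $\alpha\in(0,1)$, $\Lambda$ is almost surely $\alpha$-Carleson if and only if either $a<1+\alpha$, or $a=1+\alpha$ and $b>1$. -/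

import Mathlib

open MeasureTheory ProbabilityTheory Set
open scoped Nat

noncomputable section

/-- The radial measure `dμ(a,b) = dm / ((1-|z|²)^a log^b (e/(1-|z|²)))` on the unit disk, where `m` is
Lebesgue measure normalized so that the disk has mass one. It is viewed as a measure on `ℂ` which
gives no mass to the complement of the disk. -/
def radialMeasure (a b : ℝ) : Measure ℂ :=
  ((ENNReal.ofReal Real.pi⁻¹ • (volume : Measure ℂ)).restrict (Metric.ball 0 1)).withDensity
    fun z => ENNReal.ofReal
      (1 / ((1 - ‖z‖ ^ 2) ^ a * (Real.log (Real.exp 1 / (1 - ‖z‖ ^ 2))) ^ b))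

/-- The number (with multiplicity, possibly infinite) of terms of the random sequence `Λ` which lie
in `A`. -/
def pointCount {Ω : Type*} (Λ : ℕ → Ω → ℂ) (A : Set ℂ) (ω : Ω) : ℕ∞ :=
  {k : ℕ | Λ k ω ∈ A}.encard

/-- The random sequence `Λ` of points of the unit disk is a Poisson point process of intensity `μ`.
A Poisson variable of infinite mean is, as usual, one which is almost surely infinite. -/
structure IsPoissonProcess {Ω : Type*} [MeasurableSpace Ω] (P : Measure Ω) (μ : Measure ℂ)
    (Λ : ℕ → Ω → ℂ) : Prop where
  mem_disk : ∀ k ω, Λ k ω ∈ Metric.ball (0 : ℂ) 1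
  measurable_count : ∀ A : Set ℂ, MeasurableSet A → Measurable (pointCount Λ A)
  law_of_finite : ∀ A : Set ℂ, MeasurableSet A → μ A ≠ ⊤ → ∀ n : ℕ,
    P {ω | pointCount Λ A ω = n} =
      ENNReal.ofReal (Real.exp (-(μ A).toReal) * (μ A).toReal ^ n / n !)
  law_of_infinite : ∀ A : Set ℂ, MeasurableSet A → μ A = ⊤ → ∀ᵐ ω ∂P, pointCount Λ A ω = ⊤
  indep : ∀ A : ℕ → Set ℂ, (∀ j, MeasurableSet (A j)) → Pairwise (fun i j => Disjoint (A i) (A j)) →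
    iIndepFun (fun j => pointCount Λ (A j)) P

/-- The pseudo-hyperbolic distance. -/
def pseudoHyperbolicDist (z w : ℂ) : ℝ :=
  ‖(z - w) / (1 - (starRingEnd ℂ) w * z)‖

/-- A (finite or infinite) family of points is separated. -/
def IsSeparatedFamily {ι : Type*} (lam : ι → ℂ) : Prop :=
  ∃ δ : ℝ, 0 < δ ∧ ∀ k l : ι, k ≠ l → δ ≤ pseudoHyperbolicDist (lam k) (lam l)

/-- The sequence `lam` is a union of `M` separated (finite or infinite) sequences. -/
def IsUnionOfSeparated (M : ℕ) (lam : ℕ → ℂ) : Prop :=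
  ∃ S : Fin M → Set ℕ, (⋃ i, S i) = univ ∧ ∀ i, IsSeparatedFamily (fun k : S i => lam k)

/-- The Carleson window `Q(I)` over the closed arc `I = {e^{iθ} : θ₀ ≤ θ ≤ θ₀ + 2πh}`, whose
normalized length is `h` when `0 < h ≤ 1`. -/
def carlesonWindow (θ₀ h : ℝ) : Set ℂ :=
  {z | ∃ r ∈ Ioo (1 - h) 1, ∃ θ ∈ Icc θ₀ (θ₀ + 2 * Real.pi * h),
    z = (r : ℂ) * Complex.exp ((θ : ℂ) * Complex.I)}

/-- The `α`-Carleson condition. Since closed arcs contain the arcs of the same length with one or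
both endpoints removed, testing on closed arcs is the same as testing on all arcs. -/
def IsCarlesonSequence (α : ℝ) (lam : ℕ → ℂ) : Prop :=
  ∃ C : ℝ, 0 < C ∧ ∀ θ₀ h : ℝ, 0 < h → h ≤ 1 →
    ∑' k : {k : ℕ // lam k ∈ carlesonWindow θ₀ h}, ENNReal.ofReal ((1 - ‖lam k‖) ^ α)
      ≤ ENNReal.ofReal (C * h ^ α)

end

/-! In the shell where `1 - ‖z‖ ^ 2` is about `2 ^ (-m)`, the density of μ is about `2 ^ (m a) (m +
1) ^ (-b)`. So the shell has mass about `2 ^ (m (a - 1)) (m + 1) ^ (-b)`, and a hyperbolic cell of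
bounded size has mass `p` about `2 ^ (m (a - 2)) (m + 1) ^ (-b)`. All thresholds come from summing
such weights.

Unions of separated sequences: when `p` is small, a cell holds more than M points with probability
about `p ^ (M + 1)`, and the shell has about `2 ^ m` cells. The decisive series is `∑ 2 ^ (m (1 + (M
+ 1) (a - 2))) (m + 1) ^ (-(M + 1) b)`. If it diverges, independence over disjoint cells and the
second Borel–Cantelli lemma give crowded cells at every hyperbolic scale (`ae_exists_crowded_cell`),
and the pigeonhole principle excludes M separated classes. If it converges, the probability of a
crowded cell in an overlapping grid of hyperbolic scale `2 ^ (-j)` tends to 0 with j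
(`exists_measure_crowded_gridCell_le`). Almost surely some scale has none, and a greedy colouring
splits the sequence into M separated classes.

Carleson conditions: for `2 ≤ a` there are cells with arbitrarily many points, which contradicts the
1-Carleson bound on a single window. For α < 1 the obstruction is global: shells hold at least a
fixed fraction of the order of their mean number of points, so `∑ (1 - ‖λ‖) ^ α` is at least a
multiple of `∑ 2 ^ (m (a - 1 - α)) (m + 1) ^ (-b)` and diverges (`ae_not_isCarlesonSequence`).
Conversely, Poisson tails bound the counts in all dyadic boxes simultaneously
(`ae_isCarlesonSequence_of_bound`), and a deterministic criterion
(`isCarlesonSequence_of_encard_le`) finishes. -/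

/-! ### Dyadic weights -/

/-- The weight `2 ^ (m x) (m + 1) ^ y`. -/
noncomputable def dyadicWeight (x y : ℝ) (m : ℕ) : ℝ := (2 : ℝ) ^ ((m : ℝ) * x) * ((m : ℝ) + 1) ^ y

lemma dyadicWeight_pos (x y : ℝ) (m : ℕ) : 0 < dyadicWeight x y m := by
  unfold dyadicWeight; positivity

lemma dyadicWeight_mul (x y x' y' : ℝ) (m : ℕ) :
    dyadicWeight x y m * dyadicWeight x' y' m = dyadicWeight (x + x') (y + y') m := by
  unfold dyadicWeight
  rw [mul_add, Real.rpow_add two_pos, Real.rpow_add (by positivity)]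
  ring

lemma dyadicWeight_pow (x y : ℝ) (k m : ℕ) :
    dyadicWeight x y m ^ k = dyadicWeight (k * x) (k * y) m := by
  unfold dyadicWeight
  rw [mul_pow, ← Real.rpow_mul_natCast two_pos.le, ← Real.rpow_mul_natCast (by positivity)]
  ring_nf

lemma dyadicWeight_inv (x y : ℝ) (m : ℕ) :
    (dyadicWeight x y m)⁻¹ = dyadicWeight (-x) (-y) m := by
  unfold dyadicWeight
  rw [mul_inv, ← Real.rpow_neg two_pos.le, ← Real.rpow_neg (by positivity), mul_neg]

lemma dyadicWeight_natCast (k m : ℕ) : dyadicWeight k 0 m = ((2 : ℝ) ^ m) ^ k := by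
  unfold dyadicWeight
  rw [Real.rpow_zero, mul_one, ← Nat.cast_mul, Real.rpow_natCast, pow_mul]

lemma dyadicWeight_one (m : ℕ) : dyadicWeight 1 0 m = (2 : ℝ) ^ m := by
  simpa using dyadicWeight_natCast 1 m

lemma dyadicWeight_neg_one (m : ℕ) : dyadicWeight (-1) 0 m = ((2 : ℝ) ^ m)⁻¹ := by
  rw [← dyadicWeight_one, dyadicWeight_inv, neg_zero]

lemma exists_dyadicWeight_le {x : ℝ} (hx : x < 0) (y : ℝ) :
    ∃ C, 0 < C ∧ ∀ m, dyadicWeight x y m ≤ C := by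
  have hl : 0 < -x * Real.log 2 := mul_pos (neg_pos.2 hx) (Real.log_pos one_lt_two)
  have h1 := tendsto_rpow_mul_exp_neg_mul_atTop_nhds_zero y _ hl
  have h2 : Filter.Tendsto (fun m : ℕ => (m : ℝ) + 1) Filter.atTop Filter.atTop :=
    Filter.tendsto_atTop_add_const_right _ _ tendsto_natCast_atTop_atTop
  obtain ⟨B, hB⟩ := (h1.comp h2).bddAbove_range
  have hB' : ∀ m : ℕ, ((m : ℝ) + 1) ^ y * Real.exp (-(-x * Real.log 2) * ((m : ℝ) + 1)) ≤ B :=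
    fun m => hB ⟨m, rfl⟩
  have hB0 : 0 < B := lt_of_lt_of_le (by positivity) (hB' 0)
  refine ⟨B * 2 ^ (-x), by positivity, fun m => ?_⟩
  have : dyadicWeight x y m =
      ((m : ℝ) + 1) ^ y * Real.exp (-(-x * Real.log 2) * ((m : ℝ) + 1)) * 2 ^ (-x) := by
    unfold dyadicWeight
    rw [Real.rpow_def_of_pos two_pos, Real.rpow_def_of_pos two_pos (-x), mul_assoc _ (Real.exp _),
      ← Real.exp_add, mul_comm]
    ring_nf
  rw [this]
  gcongr
  exact hB' m

lemma exists_le_dyadicWeight {x : ℝ} (hx : 0 < x) (y : ℝ) :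
    ∃ c, 0 < c ∧ ∀ m, c ≤ dyadicWeight x y m := by
  obtain ⟨C, hC, h⟩ := exists_dyadicWeight_le (neg_lt_zero.2 hx) (-y)
  refine ⟨C⁻¹, inv_pos.2 hC, fun m => ?_⟩
  rw [inv_le_comm₀ hC (dyadicWeight_pos _ _ _), dyadicWeight_inv]
  exact h m

lemma summable_dyadicWeight_of_neg {x : ℝ} (hx : x < 0) (y : ℝ) :
    Summable (dyadicWeight x y) := by
  -- Half of the exponent absorbs the polynomial factor; the other half leaves a geometric series.
  obtain ⟨C, hC, h⟩ := exists_dyadicWeight_le (show x / 2 < 0 by linarith) y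
  have hg : Summable fun m : ℕ => C * ((2 : ℝ) ^ (x / 2)) ^ m :=
    (summable_geometric_of_lt_one (by positivity)
      (Real.rpow_lt_one_of_one_lt_of_neg one_lt_two (by linarith))).mul_left _
  refine hg.of_nonneg_of_le (fun m => (dyadicWeight_pos _ _ _).le) fun m => ?_
  have : dyadicWeight x y m = dyadicWeight (x / 2) y m * dyadicWeight (x / 2) 0 m := by
    rw [dyadicWeight_mul]; simp
  rw [this]
  have h2 : dyadicWeight (x / 2) 0 m = ((2 : ℝ) ^ (x / 2)) ^ m := by
    unfold dyadicWeight
    rw [Real.rpow_zero, mul_one, ← Real.rpow_mul_natCast two_pos.le, mul_comm]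
  rw [h2]
  gcongr
  exact h m

lemma summable_dyadicWeight_zero {y : ℝ} (hy : y < -1) : Summable (dyadicWeight 0 y) := by
  have := (summable_nat_add_iff 1).2 (Real.summable_nat_rpow.2 hy)
  refine this.congr fun m => ?_
  simp [dyadicWeight]

/-- Comparison with the harmonic series treats the strict and the boundary case of every divergent
regime at once. -/
lemma exists_div_le_dyadicWeight {x y : ℝ} (h : 0 < x ∨ (x = 0 ∧ -1 ≤ y)) :
    ∃ c, 0 < c ∧ ∀ m : ℕ, c / ((m : ℝ) + 1) ≤ dyadicWeight x y m := by
  rcases h with hx | ⟨rfl, hy⟩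
  · obtain ⟨c, hc, h⟩ := exists_le_dyadicWeight hx y
    refine ⟨c, hc, fun m => (div_le_self hc.le ?_).trans (h m)⟩
    have : (0 : ℝ) ≤ m := m.cast_nonneg
    linarith
  · refine ⟨1, one_pos, fun m => ?_⟩
    have h1 : (1 : ℝ) ≤ (m : ℝ) + 1 := by
      have : (0 : ℝ) ≤ m := m.cast_nonneg
      linarith
    have := Real.rpow_le_rpow_of_exponent_le h1 hy
    rw [Real.rpow_neg_one] at this
    simpa [dyadicWeight] using this

lemma tsum_ofReal_eq_top_of_div_le {c : ℝ} (hc : 0 < c) {f : ℕ → ℝ} (k : ℕ)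
    (h : ∀ m : ℕ, c / ((m : ℝ) + k + 1) ≤ f m) : ∑' m, ENNReal.ofReal (f m) = ⊤ := by
  have hns : ¬ Summable fun m : ℕ => c / ((m : ℝ) + k + 1) := by
    intro hs
    have h1 : Summable fun m : ℕ => 1 / ((m + (k + 1) : ℕ) : ℝ) := by
      refine (hs.mul_left c⁻¹).congr fun m => ?_
      push_cast
      field_simp
      ring_nf
    exact Real.not_summable_one_div_natCast ((summable_nat_add_iff (k + 1)).1 h1)
  by_contra hne
  apply hns
  have hf : ∀ m : ℕ, 0 ≤ c / ((m : ℝ) + k + 1) := fun m => by positivity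
  have := ENNReal.summable_toReal hne
  refine this.of_nonneg_of_le hf fun m => ?_
  rw [ENNReal.toReal_ofReal ((hf m).trans (h m))]
  exact h m

/-! ### Tails of Poisson variables -/

section Poisson

variable {Ω : Type*} [MeasurableSpace Ω] {P : Measure Ω} {μ : Measure ℂ} {Λ : ℕ → Ω → ℂ}

lemma IsPoissonProcess.measurableSet_le (hΛ : IsPoissonProcess P μ Λ) {A : Set ℂ}
    (hA : MeasurableSet A) (j : ℕ∞) : MeasurableSet {ω | j ≤ pointCount Λ A ω} :=
  hΛ.measurable_count A hA (MeasurableSet.of_discrete (s := Ici j))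

lemma IsPoissonProcess.measurableSet_eq (hΛ : IsPoissonProcess P μ Λ) {A : Set ℂ}
    (hA : MeasurableSet A) (j : ℕ∞) : MeasurableSet {ω | pointCount Λ A ω = j} :=
  hΛ.measurable_count A hA (MeasurableSet.of_discrete (s := {j}))

omit [MeasurableSpace Ω] in
lemma setOf_pointCount_lt (A : Set ℂ) (k : ℕ) :
    {ω | pointCount Λ A ω < k} = ⋃ n ∈ Finset.range k, {ω | pointCount Λ A ω = n} := by
  ext ω
  simp only [mem_ofPred_eq, Finset.mem_range, mem_iUnion, exists_prop]
  constructor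
  · intro h
    obtain ⟨n, hn⟩ := ENat.ne_top_iff_exists.1 h.ne_top
    refine ⟨n, ?_, hn.symm⟩
    rw [← hn] at h
    exact_mod_cast h
  · rintro ⟨n, hn, h⟩
    rw [h]
    exact_mod_cast hn

lemma IsPoissonProcess.measure_pointCount_lt (hΛ : IsPoissonProcess P μ Λ) {A : Set ℂ}
    (hA : MeasurableSet A) (hμ : μ A ≠ ⊤) (k : ℕ) :
    P {ω | pointCount Λ A ω < k} =
      ENNReal.ofReal (Real.exp (-(μ A).toReal) * ∑ n ∈ Finset.range k, (μ A).toReal ^ n / n !) := by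
  rw [setOf_pointCount_lt, measure_biUnion_finset
      (f := fun n : ℕ => {ω | pointCount Λ A ω = n}) ?_ fun n _ => hΛ.measurableSet_eq hA n,
    Finset.mul_sum, ENNReal.ofReal_sum_of_nonneg fun n _ => by positivity]
  · refine Finset.sum_congr rfl fun n _ => ?_
    rw [hΛ.law_of_finite A hA hμ, mul_div_assoc]
  · intro i _ j _ hij
    refine Set.disjoint_left.2 fun ω hi hj => hij ?_
    have : (i : ℕ∞) = j := hi.symm.trans hj
    exact_mod_cast this

/-- Since `i ! * j ! ≤ (i + j)!`, the factor `x ^ j / j !` comes out of the tail and leaves at most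
the full exponential series. -/
lemma Real.exp_sub_sum_range_le {x : ℝ} (hx : 0 ≤ x) (j : ℕ) :
    Real.exp x - ∑ n ∈ Finset.range j, x ^ n / n ! ≤ x ^ j / j ! * Real.exp x := by
  have hs := Real.summable_pow_div_factorial x
  have he : Real.exp x = ∑' n : ℕ, x ^ n / n ! := by
    rw [Real.exp_eq_exp_ℝ, NormedSpace.exp_eq_tsum_div]
  have h1 := hs.sum_add_tsum_nat_add j
  rw [← he] at h1
  have h2 : ∑' i : ℕ, x ^ (i + j) / (i + j)! ≤ ∑' i : ℕ, x ^ j / j ! * (x ^ i / i !) := by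
    refine Summable.tsum_le_tsum (fun i => ?_) ((summable_nat_add_iff j).2 hs) (hs.mul_left _)
    have : ((i ! * j ! : ℕ) : ℝ) ≤ ((i + j)! : ℕ) := by
      exact_mod_cast Nat.le_of_dvd (Nat.factorial_pos _)
        (Nat.factorial_mul_factorial_dvd_factorial_add i j)
    rw [div_mul_div_comm, pow_add, mul_comm (x ^ j)]
    push_cast at this
    rw [mul_comm (j ! : ℝ)]
    gcongr
  rw [tsum_mul_left, ← he] at h2
  linarith

lemma IsPoissonProcess.measure_le_pointCount_le [IsProbabilityMeasure P]
    (hΛ : IsPoissonProcess P μ Λ) {A : Set ℂ} (hA : MeasurableSet A) (hμ : μ A ≠ ⊤) (j : ℕ) :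
    P {ω | (j : ℕ∞) ≤ pointCount Λ A ω} ≤ ENNReal.ofReal ((μ A).toReal ^ j / j !) := by
  set p := (μ A).toReal with hp
  have hp0 : 0 ≤ p := ENNReal.toReal_nonneg
  have hc : {ω | (j : ℕ∞) ≤ pointCount Λ A ω} = {ω | pointCount Λ A ω < j}ᶜ := by
    ext ω; simp
  have hm : MeasurableSet {ω | pointCount Λ A ω < j} := by
    have := (hΛ.measurableSet_le hA j).compl
    rw [hc, compl_compl] at this
    exact this
  rw [hc, prob_compl_eq_one_sub hm, hΛ.measure_pointCount_lt hA hμ, ← ENNReal.ofReal_one,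
    ← ENNReal.ofReal_sub _ (by positivity)]
  apply ENNReal.ofReal_le_ofReal
  have h := Real.exp_sub_sum_range_le hp0 j
  have h2 := mul_le_mul_of_nonneg_left h (Real.exp_pos (-p)).le
  have h3 : Real.exp (-p) * Real.exp p = 1 := by rw [← Real.exp_add]; simp
  calc _ = Real.exp (-p) * (Real.exp p - ∑ n ∈ Finset.range j, p ^ n / n !) := by
        rw [mul_sub, h3]
    _ ≤ _ := h2
    _ = p ^ j / j ! * (Real.exp (-p) * Real.exp p) := by ring
    _ = _ := by rw [h3, mul_one]

/-- A Chernoff-type bound: for `n < k`, `p ^ n ≤ 2 ^ k (p / 2) ^ n`, and the truncated series at `p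
/ 2` is at most `exp (p / 2)`. -/
lemma IsPoissonProcess.measure_pointCount_lt_le (hΛ : IsPoissonProcess P μ Λ) {A : Set ℂ}
    (hA : MeasurableSet A) (hμ : μ A ≠ ⊤) (k : ℕ) :
    P {ω | pointCount Λ A ω < k} ≤ ENNReal.ofReal (2 ^ k * Real.exp (-(μ A).toReal / 2)) := by
  rw [hΛ.measure_pointCount_lt hA hμ]
  set p := (μ A).toReal with hp
  have hp0 : 0 ≤ p := ENNReal.toReal_nonneg
  apply ENNReal.ofReal_le_ofReal
  have h1 : ∑ n ∈ Finset.range k, p ^ n / n ! ≤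
      2 ^ k * ∑ n ∈ Finset.range k, (p / 2) ^ n / n ! := by
    rw [Finset.mul_sum]
    refine Finset.sum_le_sum fun n hn => ?_
    have hnk : (2 : ℝ) ^ n ≤ 2 ^ k :=
      pow_le_pow_right₀ one_le_two (Finset.mem_range.1 hn).le
    calc p ^ n / n ! = 2 ^ n * ((p / 2) ^ n / n !) := by rw [div_pow]; field_simp
      _ ≤ _ := by gcongr
  have h2 := Real.sum_le_exp_of_nonneg (by positivity : 0 ≤ p / 2) k
  calc _ ≤ Real.exp (-p) * (2 ^ k * Real.exp (p / 2)) := by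
        gcongr; exact h1.trans (by gcongr)
    _ = 2 ^ k * (Real.exp (-p) * Real.exp (p / 2)) := by ring
    _ = _ := by rw [← Real.exp_add]; ring_nf

/-- For bounded mass the event of exactly M + 1 points suffices; for large mass the lower tail shows
that crowding has probability at least 1/2. The cap at 1 keeps one constant valid for all masses. -/
lemma IsPoissonProcess.exists_mul_min_pow_le [IsProbabilityMeasure P]
    (hΛ : IsPoissonProcess P μ Λ) (M : ℕ) :
    ∃ c, 0 < c ∧ ∀ A, MeasurableSet A → μ A ≠ ⊤ → ∀ q : ℝ, 0 ≤ q → q ≤ (μ A).toReal →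
      ENNReal.ofReal (c * min 1 q ^ (M + 1)) ≤ P {ω | ((M + 1 : ℕ) : ℕ∞) ≤ pointCount Λ A ω} := by
  -- Chosen so that `exp (p₀ / 2) ≥ 4 ^ (M + 1)`; beyond it the lower tail is at most `2 ^ (-(M +
  -- 1)) ≤ 1 / 2`.
  set p₀ : ℝ := 4 * (M + 1) with hp₀
  refine ⟨min (1 / 2) (Real.exp (-p₀) / (M + 1)!), by positivity, fun A hA hμ q hq hqp => ?_⟩
  set p := (μ A).toReal with hp
  have hp0 : 0 ≤ p := ENNReal.toReal_nonneg
  by_cases hle : p ≤ p₀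
  · have hsub : {ω | pointCount Λ A ω = (M + 1 : ℕ)} ⊆
        {ω | ((M + 1 : ℕ) : ℕ∞) ≤ pointCount Λ A ω} := fun ω hω => (hω : _ = _).ge
    refine le_trans ?_ (measure_mono hsub)
    rw [hΛ.law_of_finite A hA hμ, ← hp]
    apply ENNReal.ofReal_le_ofReal
    calc _ ≤ Real.exp (-p₀) / (M + 1)! * p ^ (M + 1) := by
          gcongr
          · exact min_le_right _ _
          · exact (min_le_right _ _).trans hqp
      _ = Real.exp (-p₀) * p ^ (M + 1) / (M + 1)! := by ring
      _ ≤ _ := by gcongr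
  · have hc : {ω | ((M + 1 : ℕ) : ℕ∞) ≤ pointCount Λ A ω} =
        {ω | pointCount Λ A ω < (M + 1 : ℕ)}ᶜ := by
      ext ω; simp
    have hm := (hΛ.measurableSet_le hA (M + 1 : ℕ)).compl
    rw [hc, compl_compl] at hm
    rw [hc, prob_compl_eq_one_sub hm]
    have h1 := hΛ.measure_pointCount_lt_le hA hμ (M + 1)
    have h2 : (2 : ℝ) ^ (M + 1) * Real.exp (-p / 2) ≤ 1 / 2 := by
      have h3 : (4 : ℝ) ^ (M + 1) ≤ Real.exp (p / 2) := by
        have h4 : (4 : ℝ) ≤ Real.exp 2 := by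
          have := Real.exp_one_gt_d9
          rw [show (2 : ℝ) = 1 + 1 by norm_num, Real.exp_add]
          nlinarith
        calc (4 : ℝ) ^ (M + 1) ≤ Real.exp 2 ^ (M + 1) := by gcongr
          _ = Real.exp (p₀ / 2) := by rw [← Real.exp_nat_mul, hp₀]; push_cast; ring_nf
          _ ≤ _ := by gcongr; exact (not_le.1 hle).le
      have h5 : (2 : ℝ) ≤ 2 ^ (M + 1) := by
        simpa using pow_le_pow_right₀ (one_le_two (α := ℝ)) (Nat.le_add_left 1 M)
      have h6 : (4 : ℝ) ^ (M + 1) = 2 ^ (M + 1) * 2 ^ (M + 1) := by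
        rw [← mul_pow]; norm_num
      rw [neg_div, Real.exp_neg, ← div_eq_mul_inv, div_le_div_iff₀ (Real.exp_pos _) two_pos]
      nlinarith
    have h7 : P {ω | pointCount Λ A ω < (M + 1 : ℕ)} ≤ ENNReal.ofReal (1 / 2) :=
      h1.trans (ENNReal.ofReal_le_ofReal h2)
    calc _ ≤ ENNReal.ofReal (1 / 2) := by
          apply ENNReal.ofReal_le_ofReal
          have h8 : min 1 q ^ (M + 1) ≤ 1 := pow_le_one₀ (by positivity) (min_le_left _ _)
          have h9 : 0 ≤ min 1 q ^ (M + 1) := by positivity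
          have h10 : min (1 / 2) (Real.exp (-p₀) / (M + 1)!) ≤ 1 / 2 := min_le_left _ _
          calc _ ≤ (1 / 2 : ℝ) * 1 := by gcongr
            _ = _ := by norm_num
      _ = 1 - ENNReal.ofReal (1 / 2) := by
          rw [← ENNReal.ofReal_one, ← ENNReal.ofReal_sub _ (by norm_num)]; norm_num
      _ ≤ _ := tsub_le_tsub_left h7 1

end Poisson

/-! ### The radial measure -/

lemma rpow_mem_Icc_of_mem_Icc {y : ℝ} (h1 : 1 / 4 ≤ y) (h2 : y ≤ 4) (c : ℝ) :
    ((4 : ℝ) ^ |c|)⁻¹ ≤ y ^ c ∧ y ^ c ≤ (4 : ℝ) ^ |c| := by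
  have hy : 0 < y := by linarith
  have h3 : |Real.log y| ≤ Real.log 4 := by
    rw [abs_le]
    refine ⟨?_, Real.log_le_log hy h2⟩
    rw [← Real.log_inv]
    exact Real.log_le_log (by norm_num) (by linarith)
  have h4 : |Real.log y * c| ≤ Real.log 4 * |c| := by
    rw [abs_mul]; gcongr
  rw [Real.rpow_def_of_pos hy, Real.rpow_def_of_pos (by norm_num), ← Real.exp_neg]
  exact ⟨Real.exp_le_exp.2 (neg_le_of_abs_le h4), Real.exp_le_exp.2 (le_of_abs_le h4)⟩

/-- The density of the radial measure, as a function of `1 - ‖z‖ ^ 2`, is comparable to a dyadic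
weight on dyadic intervals. -/
lemma exists_density_bounds (a b : ℝ) : ∃ C : ℝ, 0 < C ∧ ∀ (m : ℕ) (s : ℝ),
    ((2 : ℝ) ^ m)⁻¹ / 4 ≤ s → s ≤ 2 * ((2 : ℝ) ^ m)⁻¹ → s ≤ 1 →
      C⁻¹ * dyadicWeight a (-b) m ≤ 1 / (s ^ a * Real.log (Real.exp 1 / s) ^ b) ∧
      1 / (s ^ a * Real.log (Real.exp 1 / s) ^ b) ≤ C * dyadicWeight a (-b) m := by
  -- Both ratios `s * 2 ^ m` and `log (e / s) / (m + 1)` lie in `[1/4, 4]`; their powers account for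
  -- the two factors.
  refine ⟨4 ^ |a| * 4 ^ |b|, by positivity, fun m s h1 h2 h3 => ?_⟩
  have hm : (0 : ℝ) < 2 ^ m := by positivity
  have hs : 0 < s := lt_of_lt_of_le (by positivity) h1
  have hm1 : (0 : ℝ) < (m : ℝ) + 1 := by positivity
  have hlog : Real.log (Real.exp 1 / s) = 1 - Real.log s := by
    rw [Real.log_div (Real.exp_pos 1).ne' hs.ne', Real.log_exp]
  have hl1 : (1 / 2 : ℝ) ≤ Real.log 2 := by linarith [Real.log_two_gt_d9]
  have hl2 : Real.log 2 ≤ 1 := by linarith [Real.log_two_lt_d9]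
  have hy1 : 1 / 4 ≤ s * 2 ^ m := by
    rw [div_le_iff₀ (by norm_num), inv_le_iff_one_le_mul₀ hm] at h1
    linarith
  have hy2 : s * 2 ^ m ≤ 2 := by
    rw [← div_eq_mul_inv, le_div_iff₀ hm] at h2
    exact h2
  have hls : Real.log s = Real.log (s * 2 ^ m) - m * Real.log 2 := by
    rw [Real.log_mul hs.ne' hm.ne', Real.log_pow]; ring
  have hL4 : -(2 * Real.log 2) ≤ Real.log (s * 2 ^ m) := by
    have := Real.log_le_log (by norm_num) hy1
    rw [one_div, Real.log_inv, show (4 : ℝ) = 2 ^ 2 by norm_num, Real.log_pow] at this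
    exact_mod_cast this
  have hL2 : Real.log (s * 2 ^ m) ≤ Real.log 2 := Real.log_le_log (by positivity) hy2
  have hx1 : 1 / 4 ≤ Real.log (Real.exp 1 / s) / (m + 1) := by
    rw [le_div_iff₀ hm1, hlog]
    rcases Nat.eq_zero_or_pos m with rfl | hm'
    · have := Real.log_nonpos hs.le h3
      norm_num; linarith
    · have h5 : (1 : ℝ) ≤ m := by exact_mod_cast hm'
      nlinarith
  have hx2 : Real.log (Real.exp 1 / s) / (m + 1) ≤ 4 := by
    rw [div_le_iff₀ hm1, hlog]
    have : (m : ℝ) * Real.log 2 ≤ m * 1 := by gcongr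
    have h0 : (0 : ℝ) ≤ m := m.cast_nonneg
    linarith
  obtain ⟨ha1, ha2⟩ := rpow_mem_Icc_of_mem_Icc hy1 (by linarith) a
  obtain ⟨hb1, hb2⟩ := rpow_mem_Icc_of_mem_Icc hx1 hx2 b
  set x := Real.log (Real.exp 1 / s) / (m + 1) with hx
  set y := s * 2 ^ m with hy
  have hx0 : 0 < x := by linarith
  have hy0 : 0 < y := by linarith
  have hLx : Real.log (Real.exp 1 / s) = x * (m + 1) := by rw [hx]; field_simp
  have hsy : s = y * (2 ^ m)⁻¹ := by rw [hy]; field_simp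
  have key : 1 / (s ^ a * Real.log (Real.exp 1 / s) ^ b) =
      (y ^ a * x ^ b)⁻¹ * dyadicWeight a (-b) m := by
    rw [hLx, Real.mul_rpow hx0.le hm1.le, hsy, Real.mul_rpow hy0.le (by positivity)]
    unfold dyadicWeight
    rw [Real.rpow_neg hm1.le, Real.rpow_mul two_pos.le, Real.rpow_natCast,
      Real.inv_rpow hm.le]
    field_simp
  have hw := dyadicWeight_pos a (-b) m
  rw [key]
  constructor
  · gcongr
  · have : (y ^ a * x ^ b)⁻¹ ≤ 4 ^ |a| * 4 ^ |b| := by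
      rw [inv_le_comm₀ (by positivity) (by positivity), mul_inv]
      gcongr
    gcongr

/-- The normalized Lebesgue measure, on all of `ℂ`. -/
noncomputable def normalizedVolume : Measure ℂ := ENNReal.ofReal Real.pi⁻¹ • (volume : Measure ℂ)

lemma normalizedVolume_closedBall {r : ℝ} (hr : 0 ≤ r) (z : ℂ) :
    normalizedVolume (Metric.closedBall z r) = ENNReal.ofReal (r ^ 2) := by
  rw [normalizedVolume, Measure.smul_apply, Complex.volume_closedBall, smul_eq_mul,
    mul_comm (_ ^ 2), ← mul_assoc, ← ENNReal.ofReal_pow hr]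
  have : (NNReal.pi : ENNReal) = ENNReal.ofReal Real.pi := by
    rw [← NNReal.coe_real_pi, ENNReal.ofReal_coe_nnreal]
  rw [this, ← ENNReal.ofReal_mul (by positivity), inv_mul_cancel₀ Real.pi_ne_zero,
    ENNReal.ofReal_one, one_mul]

/-- The shell `s ≤ 1 - ‖z‖ ^ 2 < t`. -/
def diskShell (s t : ℝ) : Set ℂ := {z | s ≤ 1 - ‖z‖ ^ 2 ∧ 1 - ‖z‖ ^ 2 < t}

lemma measurableSet_diskShell (s t : ℝ) : MeasurableSet (diskShell s t) := by
  unfold diskShell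
  have h : Measurable fun z : ℂ => 1 - ‖z‖ ^ 2 := by fun_prop
  exact (measurableSet_le measurable_const h).inter (measurableSet_lt h measurable_const)

/-- Normalized area is linear in the coordinate `1 - ‖z‖ ^ 2`, which is why shells are cut in that
coordinate. -/
lemma normalizedVolume_diskShell {s t : ℝ} (hst : s ≤ t) (ht : t ≤ 1) :
    normalizedVolume (diskShell s t) = ENNReal.ofReal (t - s) := by
  have : diskShell s t =
      Metric.closedBall 0 (Real.sqrt (1 - s)) \ Metric.closedBall 0 (Real.sqrt (1 - t)) := by
    ext z
    simp only [diskShell, mem_ofPred_eq, mem_sdiff, mem_closedBall_zero_iff, not_le]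
    rw [Real.le_sqrt (norm_nonneg _) (by linarith), Real.sqrt_lt (by linarith) (norm_nonneg _)]
    constructor <;> rintro ⟨h1, h2⟩ <;> constructor <;> linarith
  rw [this, measure_sdiff (Metric.closedBall_subset_closedBall (Real.sqrt_le_sqrt (by linarith)))
    measurableSet_closedBall.nullMeasurableSet,
    normalizedVolume_closedBall (by positivity), normalizedVolume_closedBall (by positivity),
    Real.sq_sqrt (by linarith), Real.sq_sqrt (by linarith), ← ENNReal.ofReal_sub _ (by linarith)]
  · ring_nf
  · rw [normalizedVolume_closedBall (by positivity)]
    exact ENNReal.ofReal_ne_top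

lemma radialMeasure_apply (a b : ℝ) {B : Set ℂ} (hB : MeasurableSet B) :
    radialMeasure a b B = ∫⁻ z in B ∩ Metric.ball 0 1, ENNReal.ofReal
      (1 / ((1 - ‖z‖ ^ 2) ^ a * (Real.log (Real.exp 1 / (1 - ‖z‖ ^ 2))) ^ b))
        ∂normalizedVolume := by
  rw [radialMeasure, withDensity_apply _ hB, Measure.restrict_restrict hB]
  rfl

/-- The range is wide enough to cover both the disjoint shells of the lower bounds and the
overlapping shells of the upper bounds. -/
lemma exists_radialMeasure_bounds (a b : ℝ) : ∃ C : ℝ, 0 < C ∧ ∀ (m : ℕ) (B : Set ℂ),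
    MeasurableSet B → B ⊆ diskShell (((2 : ℝ) ^ m)⁻¹ / 4) (2 * ((2 : ℝ) ^ m)⁻¹) →
      ENNReal.ofReal (C⁻¹ * dyadicWeight a (-b) m) * normalizedVolume B ≤ radialMeasure a b B ∧
      radialMeasure a b B ≤ ENNReal.ofReal (C * dyadicWeight a (-b) m) * normalizedVolume B := by
  obtain ⟨C, hC, h⟩ := exists_density_bounds a b
  refine ⟨C, hC, fun m B hB hsub => ?_⟩
  have hball : B ∩ Metric.ball 0 1 = B := by
    refine inter_eq_left.2 fun z hz => ?_
    have h1 := (hsub hz).1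
    have h2 : (0 : ℝ) < ((2 : ℝ) ^ m)⁻¹ / 4 := by positivity
    rw [mem_ball_zero_iff]
    nlinarith [norm_nonneg z]
  have hz : ∀ z ∈ B, _ := fun z hz => h m (1 - ‖z‖ ^ 2) (hsub hz).1 (hsub hz).2.le
    (by nlinarith [norm_nonneg z])
  rw [radialMeasure_apply a b hB, hball, ← setLIntegral_const, ← setLIntegral_const]
  exact ⟨setLIntegral_mono' hB fun z hzB => ENNReal.ofReal_le_ofReal (hz z hzB).1,
    setLIntegral_mono' hB fun z hzB => ENNReal.ofReal_le_ofReal (hz z hzB).2⟩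

lemma measurePreserving_rotation_radialMeasure (a b : ℝ) (c : Circle) :
    MeasurePreserving (rotation c) (radialMeasure a b) (radialMeasure a b) := by
  have hvol : MeasurePreserving (rotation c) normalizedVolume normalizedVolume :=
    (rotation c).measurePreserving.smul_measure _
  have hpre : rotation c ⁻¹' Metric.ball 0 1 = Metric.ball 0 1 := by
    ext z; simp only [mem_preimage, mem_ball_zero_iff, LinearIsometryEquiv.norm_map]
  have hm : Measurable (rotation c) := hvol.measurable
  refine ⟨hm, Measure.ext fun S hS => ?_⟩
  rw [Measure.map_apply hm hS, radialMeasure_apply a b hS, radialMeasure_apply a b (hm hS),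
    ← hvol.setLIntegral_comp_preimage (hS.inter measurableSet_ball) (by fun_prop), preimage_inter,
    hpre]
  simp only [LinearIsometryEquiv.norm_map]

/-! ### Sectors -/

/-- The index of the sector, among `N` equal ones, which contains `z`. -/
noncomputable def sectorIndex (N : ℕ) (z : ℂ) : ZMod N :=
  ((⌊(N : ℝ) * (Complex.arg z / (2 * Real.pi))⌋ : ℤ) : ZMod N)

/-- Adding a turn to the angle moves the floor by N, so taking values in `ZMod N` makes the choice
of argument irrelevant. -/
lemma sectorIndex_polar (N : ℕ) {r : ℝ} (hr : 0 < r) (θ : ℝ) :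
    sectorIndex N (r * Complex.exp (θ * Complex.I)) =
      ((⌊(N : ℝ) * (θ / (2 * Real.pi))⌋ : ℤ) : ZMod N) := by
  unfold sectorIndex
  rw [Complex.arg_real_mul _ hr, Complex.arg_exp_mul_I, ← self_sub_toIocDiv_zsmul]
  set n := toIocDiv Real.two_pi_pos (-Real.pi) θ
  have hpi := Real.pi_ne_zero
  have : (N : ℝ) * ((θ - n • (2 * Real.pi)) / (2 * Real.pi)) =
      (N : ℝ) * (θ / (2 * Real.pi)) - ((N * n : ℤ) : ℝ) := by
    push_cast
    rw [zsmul_eq_mul]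
    field_simp
  rw [this, Int.floor_sub_intCast]
  simp

lemma measurableSet_sectorIndex (N : ℕ) (k : ZMod N) : MeasurableSet {z | sectorIndex N z = k} := by
  have h : Measurable fun z : ℂ => ⌊(N : ℝ) * (Complex.arg z / (2 * Real.pi))⌋ :=
    Int.measurable_floor.comp ((Complex.measurable_arg.div_const _).const_mul _)
  exact h (MeasurableSet.of_discrete (s := {i : ℤ | (i : ZMod N) = k}))

lemma sectorIndex_rotation {N : ℕ} [NeZero N] {z : ℂ} (hz : z ≠ 0) :
    sectorIndex N (rotation (Circle.exp (2 * Real.pi / N)) z) = sectorIndex N z + 1 := by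
  have hN : (N : ℝ) ≠ 0 := NeZero.ne _
  have hpi := Real.pi_ne_zero
  have h1 : rotation (Circle.exp (2 * Real.pi / N)) z =
      (‖z‖ : ℝ) * Complex.exp (((Complex.arg z + 2 * Real.pi / N : ℝ) : ℂ) * Complex.I) := by
    rw [rotation_apply, Circle.coe_exp]
    nth_rewrite 1 [← Complex.norm_mul_exp_arg_mul_I z]
    rw [mul_left_comm, ← Complex.exp_add]
    push_cast
    ring_nf
  rw [h1, sectorIndex_polar N (norm_pos_iff.2 hz)]
  have h2 : (N : ℝ) * ((Complex.arg z + 2 * Real.pi / N) / (2 * Real.pi)) =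
      (N : ℝ) * (Complex.arg z / (2 * Real.pi)) + 1 := by
    field_simp
  rw [h2, Int.floor_add_one]
  simp [sectorIndex]

/-- The rotation by `2π / N` preserves the measure and carries each sector to the next, so all N
have equal mass. -/
lemma radialMeasure_sector (a b : ℝ) {s t : ℝ} (ht : t ≤ 1) {N : ℕ} [NeZero N] (k : ZMod N) :
    (N : ENNReal) * radialMeasure a b (diskShell s t ∩ {z | sectorIndex N z = k}) =
      radialMeasure a b (diskShell s t) := by
  set S : ZMod N → Set ℂ := fun k => diskShell s t ∩ {z | sectorIndex N z = k} with hS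
  have hSm : ∀ k, MeasurableSet (S k) := fun k =>
    (measurableSet_diskShell s t).inter (measurableSet_sectorIndex N k)
  have hstep : ∀ k, radialMeasure a b (S (k + 1)) = radialMeasure a b (S k) := by
    intro k
    rw [← (measurePreserving_rotation_radialMeasure a b
      (Circle.exp (2 * Real.pi / N))).measure_preimage (hSm _).nullMeasurableSet]
    congr 1
    ext z
    simp only [hS, mem_preimage, mem_inter_iff, mem_ofPred_eq, diskShell,
      LinearIsometryEquiv.norm_map]
    refine and_congr_right fun h => ?_
    -- The origin is fixed by rotations, so its sector would not shift; `t ≤ 1` excludes it from the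
    -- shell.
    have hz : z ≠ 0 := by
      rintro rfl
      have := h.2
      rw [norm_zero] at this
      linarith
    rw [sectorIndex_rotation hz, add_left_inj]
  have hall : ∀ n : ℕ, radialMeasure a b (S n) = radialMeasure a b (S 0) := by
    intro n
    induction n with
    | zero => simp
    | succ n ih => rw [Nat.cast_succ, hstep, ih]
  have hall' : ∀ k, radialMeasure a b (S k) = radialMeasure a b (S 0) := by
    intro k
    rw [← hall k.val, ZMod.natCast_zmod_val]
  have hU : diskShell s t = ⋃ k ∈ (Finset.univ : Finset (ZMod N)), S k := by
    ext z; simp [hS]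
  rw [show diskShell s t ∩ {z | sectorIndex N z = k} = S k from rfl]
  conv_rhs => rw [hU]
  rw [measure_biUnion_finset ?_ fun k _ => hSm k, Finset.sum_congr rfl fun k _ => hall' k,
    Finset.sum_const, Finset.card_univ, ZMod.card, nsmul_eq_mul, hall']
  intro i _ j _ hij
  exact Set.disjoint_left.2 fun z hi hj => hij (hi.2.symm.trans hj.2)

lemma sub_sq_le_two_mul_one_sub_norm {z : ℂ} (hz : ‖z‖ ≤ 1) : 1 - ‖z‖ ^ 2 ≤ 2 * (1 - ‖z‖) := by
  nlinarith [norm_nonneg z]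

lemma one_sub_norm_le {z : ℂ} (hz : ‖z‖ ≤ 1) : 1 - ‖z‖ ≤ 1 - ‖z‖ ^ 2 := by
  nlinarith [norm_nonneg z]

lemma exists_angle_of_sectorIndex_eq {N : ℕ} [NeZero N] {z : ℂ} {i : ℤ}
    (h : sectorIndex N z = i) :
    ∃ θ : ℝ, i ≤ N * (θ / (2 * Real.pi)) ∧ N * (θ / (2 * Real.pi)) < i + 1 ∧
      z = (‖z‖ : ℝ) * Complex.exp (θ * Complex.I) := by
  have hpi := Real.pi_ne_zero
  unfold sectorIndex at h
  obtain ⟨q, hq⟩ := (ZMod.intCast_eq_intCast_iff_dvd_sub _ _ _).1 h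
  set x := (N : ℝ) * (Complex.arg z / (2 * Real.pi)) with hx
  have hθ : (N : ℝ) * ((Complex.arg z + q * (2 * Real.pi)) / (2 * Real.pi)) = x + N * q := by
    rw [hx]; field_simp
  have h1 := Int.floor_le x
  have h2 := Int.lt_floor_add_one x
  have hqR : (i : ℝ) - ⌊x⌋ = N * q := by exact_mod_cast hq
  refine ⟨Complex.arg z + q * (2 * Real.pi), ?_, ?_, ?_⟩
  · rw [hθ]; linarith
  · rw [hθ]; linarith
  · have : Complex.exp (((Complex.arg z + q * (2 * Real.pi) : ℝ) : ℂ) * Complex.I) =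
        Complex.exp (Complex.arg z * Complex.I) := by
      rw [Complex.exp_eq_exp_iff_exists_int]
      exact ⟨q, by push_cast; ring⟩
    rw [this, Complex.norm_mul_exp_arg_mul_I]

lemma mem_carlesonWindow_of_sectorIndex_eq {N : ℕ} [NeZero N] {z : ℂ} {i : ℤ} {h : ℝ}
    (hi : sectorIndex N z = i) (hN : 1 / (N : ℝ) ≤ h) (h1 : 1 - h < ‖z‖) (h2 : ‖z‖ < 1) :
    z ∈ carlesonWindow (2 * Real.pi * i / N) h := by
  obtain ⟨θ, hθ1, hθ2, hz⟩ := exists_angle_of_sectorIndex_eq hi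
  have hN0 : (0 : ℝ) < N := Nat.cast_pos.2 (NeZero.pos N)
  have hpi := Real.pi_pos
  refine ⟨‖z‖, ⟨h1, h2⟩, θ, ⟨?_, ?_⟩, hz⟩
  · rw [div_le_iff₀ hN0]
    rw [mul_div_assoc', le_div_iff₀ (by positivity)] at hθ1
    linarith
  · rw [mul_div_assoc', div_lt_iff₀ (by positivity)] at hθ2
    rw [div_le_iff₀ hN0] at hN
    rw [← sub_le_iff_le_add', ← mul_le_mul_iff_left₀ hN0, sub_mul, div_mul_cancel₀ _ hN0.ne']
    nlinarith

lemma norm_polar_sub_le {r s θ τ : ℝ} (hs0 : 0 ≤ s) (hs1 : s ≤ 1) :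
    ‖(r : ℂ) * Complex.exp (θ * Complex.I) - (s : ℂ) * Complex.exp (τ * Complex.I)‖ ≤
      |r - s| + |θ - τ| := by
  have h1 : (r : ℂ) * Complex.exp (θ * Complex.I) - (s : ℂ) * Complex.exp (τ * Complex.I) =
      ((r - s : ℝ) : ℂ) * Complex.exp (θ * Complex.I) +
        s * (Complex.exp (τ * Complex.I) *
          (Complex.exp (Complex.I * ((θ - τ : ℝ) : ℂ)) - 1)) := by
    rw [mul_sub, mul_one, ← Complex.exp_add]
    push_cast
    ring_nf
  rw [h1]
  refine (norm_add_le _ _).trans ?_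
  rw [norm_mul, norm_mul, norm_mul, Complex.norm_exp_ofReal_mul_I, Complex.norm_exp_ofReal_mul_I,
    Complex.norm_real, Complex.norm_real, Real.norm_of_nonneg hs0, mul_one, one_mul]
  have h2 := Real.norm_exp_I_mul_ofReal_sub_one_le (x := θ - τ)
  gcongr
  · exact le_rfl
  · calc _ ≤ 1 * ‖θ - τ‖ := by gcongr
      _ = _ := by rw [one_mul, Real.norm_eq_abs]

/-! ### Shells and cells -/

/-- The outer part of the `m`-th dyadic shell, of relative thickness `2 ^ (-j)`. -/
def thinShell (j m : ℕ) : Set ℂ :=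
  diskShell (((2 : ℝ) ^ m)⁻¹ * (1 - ((2 : ℝ) ^ j)⁻¹ / 2)) ((2 : ℝ) ^ m)⁻¹

lemma inv_two_pow_le_one (m : ℕ) : ((2 : ℝ) ^ m)⁻¹ ≤ 1 := inv_le_one_of_one_le₀ (one_le_pow₀ one_le_two)

lemma thinShell_bounds {j m : ℕ} {z : ℂ} (hz : z ∈ thinShell j m) :
    ((2 : ℝ) ^ m)⁻¹ / 2 ≤ 1 - ‖z‖ ^ 2 ∧ 1 - ‖z‖ ^ 2 < ((2 : ℝ) ^ m)⁻¹ := by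
  refine ⟨le_trans ?_ hz.1, hz.2⟩
  have h1 := inv_two_pow_le_one j
  have h2 : (0 : ℝ) < ((2 : ℝ) ^ m)⁻¹ := by positivity
  nlinarith

lemma norm_lt_one_of_mem_thinShell {j m : ℕ} {z : ℂ} (hz : z ∈ thinShell j m) : ‖z‖ < 1 := by
  have h1 := (thinShell_bounds hz).1
  have h2 : (0 : ℝ) < ((2 : ℝ) ^ m)⁻¹ := by positivity
  nlinarith [norm_nonneg z]

lemma disjoint_thinShell {j m m' : ℕ} (h : m ≠ m') : Disjoint (thinShell j m) (thinShell j m') := by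
  wlog hlt : m < m' generalizing m m'
  · exact (this h.symm (by omega)).symm
  refine Set.disjoint_left.2 fun z hz hz' => ?_
  have h1 := (thinShell_bounds hz).1
  have h2 := (thinShell_bounds hz').2
  have h3 : ((2 : ℝ) ^ m')⁻¹ ≤ ((2 : ℝ) ^ (m + 1))⁻¹ := by
    gcongr
    · exact one_le_two
    · exact hlt
  rw [pow_succ, mul_inv] at h3
  linarith

/-- The part of a thin shell in one of `N` equal sectors. -/
def shellCell (j m N : ℕ) (k : ZMod N) : Set ℂ := thinShell j m ∩ {z | sectorIndex N z = k}

lemma measurableSet_shellCell (j m N : ℕ) (k : ZMod N) : MeasurableSet (shellCell j m N k) :=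
  (measurableSet_diskShell _ _).inter (measurableSet_sectorIndex N k)

/-- Density times the shell's area `2 ^ (-m) 2 ^ (-j) / 2`, shared equally by N sectors. The
constant does not depend on `j`; the upper bound simply drops the factor `2 ^ (-j)`. -/
lemma exists_radialMeasure_shellCell_bounds (a b : ℝ) : ∃ C : ℝ, 0 < C ∧
    ∀ (j m N : ℕ) [NeZero N] (k : ZMod N), radialMeasure a b (shellCell j m N k) ≠ ⊤ ∧
      C⁻¹ * ((2 : ℝ) ^ j)⁻¹ * dyadicWeight (a - 1) (-b) m / N ≤
        (radialMeasure a b (shellCell j m N k)).toReal ∧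
      (radialMeasure a b (shellCell j m N k)).toReal ≤ C * dyadicWeight (a - 1) (-b) m / N := by
  obtain ⟨C, hC, h⟩ := exists_radialMeasure_bounds a b
  refine ⟨2 * C, by positivity, fun j m N _ k => ?_⟩
  have hN0 : (0 : ℝ) < N := Nat.cast_pos.2 (NeZero.pos N)
  have hm0 : (0 : ℝ) < ((2 : ℝ) ^ m)⁻¹ := by positivity
  have hj0 : (0 : ℝ) < ((2 : ℝ) ^ j)⁻¹ := by positivity
  have hj1 := inv_two_pow_le_one j
  have hw := dyadicWeight_pos a (-b) m
  obtain ⟨h1, h2⟩ := h m (thinShell j m) (measurableSet_diskShell _ _) fun z hz =>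
    ⟨by have := (thinShell_bounds hz).1; linarith, by have := (thinShell_bounds hz).2; linarith⟩
  have hvol : normalizedVolume (thinShell j m) =
      ENNReal.ofReal (((2 : ℝ) ^ m)⁻¹ * (((2 : ℝ) ^ j)⁻¹ / 2)) := by
    rw [thinShell, normalizedVolume_diskShell (by nlinarith) (inv_two_pow_le_one m)]
    ring_nf
  have hww : dyadicWeight a (-b) m * ((2 : ℝ) ^ m)⁻¹ = dyadicWeight (a - 1) (-b) m := by
    rw [← dyadicWeight_neg_one, dyadicWeight_mul]
    ring_nf
  rw [hvol, ← ENNReal.ofReal_mul (by positivity)] at h1 h2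
  have hsec := radialMeasure_sector a b (s := ((2 : ℝ) ^ m)⁻¹ * (1 - ((2 : ℝ) ^ j)⁻¹ / 2))
    (inv_two_pow_le_one m) k
  change (N : ENNReal) * radialMeasure a b (shellCell j m N k) =
    radialMeasure a b (thinShell j m) at hsec
  have hsh : radialMeasure a b (thinShell j m) ≠ ⊤ := ne_top_of_le_ne_top ENNReal.ofReal_ne_top h2
  have hc : radialMeasure a b (shellCell j m N k) ≠ ⊤ :=
    ne_top_of_le_ne_top hsh (measure_mono inter_subset_left)
  have hsec' : (radialMeasure a b (shellCell j m N k)).toReal =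
      (radialMeasure a b (thinShell j m)).toReal / N := by
    rw [← hsec, ENNReal.toReal_mul, ENNReal.toReal_natCast]
    field_simp
  rw [ENNReal.ofReal_le_iff_le_toReal hsh] at h1
  have h2' := ENNReal.toReal_le_of_le_ofReal (by positivity) h2
  refine ⟨hc, ?_, ?_⟩
  · rw [hsec', ← hww]
    gcongr
    refine le_trans (le_of_eq ?_) h1
    rw [mul_inv]
    ring
  · rw [hsec', ← hww]
    gcongr
    refine h2'.trans ?_
    calc _ = C * (dyadicWeight a (-b) m * ((2 : ℝ) ^ m)⁻¹) * (((2 : ℝ) ^ j)⁻¹ / 2) := by ring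
      _ ≤ C * (dyadicWeight a (-b) m * ((2 : ℝ) ^ m)⁻¹) * 2 := by gcongr; linarith
      _ = _ := by ring

/-- The cell has Euclidean diameter at most `8 * 2 ^ (-m-j)`, while `‖1 - conj w * z‖ ≥ 2 ^ (-m) /
4`; hence 32. -/
lemma pseudoHyperbolicDist_le_of_mem_shellCell {j m : ℕ} (hm : 1 ≤ m)
    {k : ZMod (2 ^ (m + j))} {z w : ℂ} (hz : z ∈ shellCell j m (2 ^ (m + j)) k)
    (hw : w ∈ shellCell j m (2 ^ (m + j)) k) :
    pseudoHyperbolicDist z w ≤ 32 * ((2 : ℝ) ^ j)⁻¹ := by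
  have hk : ∀ {z}, z ∈ shellCell j m (2 ^ (m + j)) k →
      sectorIndex (2 ^ (m + j)) z = ((k.val : ℤ) : ZMod (2 ^ (m + j))) := fun hz => by
    rw [Int.cast_natCast, ZMod.natCast_zmod_val]; exact hz.2
  obtain ⟨θ, hθ1, hθ2, hzθ⟩ := exists_angle_of_sectorIndex_eq (hk hz)
  obtain ⟨τ, hτ1, hτ2, hwτ⟩ := exists_angle_of_sectorIndex_eq (hk hw)
  have hpi := Real.pi_pos
  have hpi2 := Real.pi_lt_d2
  set M : ℝ := ((2 : ℝ) ^ m)⁻¹ with hM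
  set J : ℝ := ((2 : ℝ) ^ j)⁻¹ with hJ
  have hM0 : 0 < M := by positivity
  have hJ0 : 0 < J := by positivity
  have hM1 : M ≤ 1 / 2 := by
    rw [hM, one_div]
    gcongr
    simpa using pow_le_pow_right₀ (one_le_two (α := ℝ)) hm
  have hz1 := norm_lt_one_of_mem_thinShell hz.1
  have hw1 := norm_lt_one_of_mem_thinShell hw.1
  have hsz := (thinShell_bounds hz.1)
  have hsw := (thinShell_bounds hw.1)
  have hang : |θ - τ| ≤ 7 * (M * J) := by
    have hN : ((2 ^ (m + j) : ℕ) : ℝ) = (M * J)⁻¹ := by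
      rw [hM, hJ, ← mul_inv, inv_inv, pow_add]; push_cast; rfl
    rw [hN] at hθ1 hθ2 hτ1 hτ2
    have h3 : |(M * J)⁻¹ * (θ / (2 * Real.pi)) - (M * J)⁻¹ * (τ / (2 * Real.pi))| ≤ 1 := by
      rw [abs_le]; constructor <;> linarith
    have h4 : (M * J)⁻¹ * (θ / (2 * Real.pi)) - (M * J)⁻¹ * (τ / (2 * Real.pi)) =
        (θ - τ) / (M * J * (2 * Real.pi)) := by
      field_simp
    rw [h4, abs_div, abs_of_pos (a := M * J * (2 * Real.pi)) (by positivity),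
      div_le_one (by positivity)] at h3
    refine h3.trans ?_
    have : 0 < M * J := by positivity
    nlinarith
  -- The shell controls `‖z‖ ^ 2 - ‖w‖ ^ 2`; since `1 ≤ m`, both norms are at least 1/2 and dividing
  -- by their sum costs nothing.
  have hrad : |‖z‖ - ‖w‖| ≤ M * J / 2 := by
    have h1 : 1 / 2 ≤ ‖z‖ := by nlinarith [norm_nonneg z]
    have h2 : 1 / 2 ≤ ‖w‖ := by nlinarith [norm_nonneg w]
    have h3 : |‖z‖ - ‖w‖| * (‖z‖ + ‖w‖) ≤ M * J / 2 := by
      rw [← abs_of_pos (show 0 < ‖z‖ + ‖w‖ by linarith), ← abs_mul, abs_le]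
      have a1 := hz.1.1
      have a2 := hz.1.2
      have a3 := hw.1.1
      have a4 := hw.1.2
      constructor <;> nlinarith
    have := abs_nonneg (‖z‖ - ‖w‖)
    nlinarith
  have hnum : ‖z - w‖ ≤ 8 * (M * J) := by
    rw [hzθ, hwτ]
    refine (norm_polar_sub_le (norm_nonneg w) hw1.le).trans ?_
    have : 0 < M * J := by positivity
    linarith
  have hden : M / 4 ≤ ‖1 - (starRingEnd ℂ) w * z‖ := by
    have h1 : 1 - ‖w‖ * ‖z‖ ≤ ‖1 - (starRingEnd ℂ) w * z‖ := by
      have := norm_sub_norm_le (1 : ℂ) ((starRingEnd ℂ) w * z)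
      rwa [norm_one, norm_mul, RCLike.norm_conj] at this
    have h2 := sub_sq_le_two_mul_one_sub_norm hz1.le
    nlinarith [norm_nonneg z, norm_nonneg w]
  unfold pseudoHyperbolicDist
  rw [norm_div, div_le_iff₀ (lt_of_lt_of_le (by positivity) hden)]
  nlinarith

/-! ### Crowded cells: failure of separation and of the 1-Carleson condition -/

section RadialPoisson

variable {Ω : Type*} [MeasurableSpace Ω] {P : Measure Ω} [IsProbabilityMeasure P] {a b : ℝ}
  {Λ : ℕ → Ω → ℂ}

/-- Some cell at scale `j` contains more than `M` points. -/
lemma ae_exists_crowded_cell (hΛ : IsPoissonProcess P (radialMeasure a b) Λ) {M : ℕ}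
    (hab : 2 - 1 / ((M : ℝ) + 1) < a ∨ (a = 2 - 1 / ((M : ℝ) + 1) ∧ b ≤ 1 / ((M : ℝ) + 1)))
    (j : ℕ) : ∀ᵐ ω ∂P, ∃ m, 1 ≤ m ∧ ∃ k : ZMod (2 ^ (m + j)),
      ((M + 1 : ℕ) : ℕ∞) ≤ pointCount Λ (shellCell j m (2 ^ (m + j)) k) ω := by
  -- The cells of all shells are enumerated as one disjoint sequence, so that the second
  -- Borel–Cantelli lemma applies. The shift to `m + 1` skips the shell containing points near the
  -- origin.
  have hinf : Infinite (Σ m : ℕ, ZMod (2 ^ (m + 1 + j))) :=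
    Infinite.of_injective (fun m => ⟨m, 0⟩) fun m m' h => congrArg Sigma.fst h
  obtain ⟨_⟩ := nonempty_denumerable (Σ m : ℕ, ZMod (2 ^ (m + 1 + j)))
  set e := (Denumerable.eqv (Σ m : ℕ, ZMod (2 ^ (m + 1 + j)))).symm with he
  set A : (Σ m : ℕ, ZMod (2 ^ (m + 1 + j))) → Set ℂ :=
    fun x => shellCell j (x.1 + 1) (2 ^ (x.1 + 1 + j)) x.2 with hA
  set s : (Σ m : ℕ, ZMod (2 ^ (m + 1 + j))) → Set Ω :=
    fun x => {ω | ((M + 1 : ℕ) : ℕ∞) ≤ pointCount Λ (A x) ω} with hs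
  have hAm : ∀ x, MeasurableSet (A x) := fun x => measurableSet_shellCell _ _ _ _
  have hsm : ∀ x, MeasurableSet (s x) := fun x => hΛ.measurableSet_le (hAm x) _
  have hdisj : Pairwise fun x y => Disjoint (A x) (A y) := by
    rintro ⟨m, k⟩ ⟨m', k'⟩ hne
    by_cases hm : m = m'
    · subst hm
      exact Set.disjoint_left.2 fun z hz hz' => hne (congrArg _ (hz.2.symm.trans hz'.2))
    · exact (disjoint_thinShell ((Nat.succ_injective.ne) hm)).mono inter_subset_left inter_subset_left
  have hind : iIndepSet (fun i => s (e i)) P := by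
    rw [iIndepSet_iff_meas_biInter fun i => hsm _]
    intro t
    refine (hΛ.indep (fun i => A (e i)) (fun i => hAm _)
      fun i i' h => hdisj (e.injective.ne h)).meas_biInter fun i _ => ?_
    exact ⟨Ici ((M + 1 : ℕ) : ℕ∞), MeasurableSet.of_discrete, rfl⟩
  have hsum : ∑' i, P (s (e i)) = ⊤ := by
    rw [e.tsum_eq (fun x => P (s x)), ENNReal.tsum_sigma']
    obtain ⟨c, hc, hcP⟩ := hΛ.exists_mul_min_pow_le M
    obtain ⟨C, hC, hCμ⟩ := exists_radialMeasure_shellCell_bounds a b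
    -- One factor `2 ^ (-j)` is the radial thickness, the other the angular width of a cell.
    obtain ⟨D, hD⟩ : ∃ D, D = C⁻¹ * ((2 : ℝ) ^ j)⁻¹ * ((2 : ℝ) ^ j)⁻¹ := ⟨_, rfl⟩
    have hD0 : 0 < D := by rw [hD]; positivity
    set q : ℕ → ℝ := fun m => D * dyadicWeight (a - 2) (-b) (m + 1) with hq
    have hq0 : ∀ m, 0 < q m := fun m => mul_pos hD0 (dyadicWeight_pos _ _ _)
    have hM0 : (0 : ℝ) < (M : ℝ) + 1 := by positivity
    obtain ⟨c', hc', hw⟩ := exists_div_le_dyadicWeight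
      (x := 1 + ((M + 1 : ℕ) : ℝ) * (a - 2)) (y := ((M + 1 : ℕ) : ℝ) * (-b)) (by
        push_cast
        rcases hab with h | ⟨rfl, h⟩
        · left
          rw [sub_lt_comm, lt_div_iff₀ hM0] at h
          linarith
        · right
          rw [le_div_iff₀ hM0] at h
          constructor
          · field_simp; ring
          · linarith)
    have hterm : ∀ m, ENNReal.ofReal (2 ^ (m + 1) * (c * min 1 (q m) ^ (M + 1))) ≤
        ∑' k, P (s ⟨m, k⟩) := by
      intro m
      have h1 : ∀ k, ENNReal.ofReal (c * min 1 (q m) ^ (M + 1)) ≤ P (s ⟨m, k⟩) := by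
        intro k
        obtain ⟨h1, h2, -⟩ := hCμ j (m + 1) (2 ^ (m + 1 + j)) k
        refine hcP _ (hAm ⟨m, k⟩) h1 (q m) (hq0 m).le (le_trans (le_of_eq ?_) h2)
        have : dyadicWeight (a - 2) (-b) (m + 1) =
            dyadicWeight (a - 1) (-b) (m + 1) * ((2 : ℝ) ^ (m + 1))⁻¹ := by
          rw [← dyadicWeight_neg_one, dyadicWeight_mul]
          ring_nf
        rw [hq, hD]
        simp only
        rw [this, pow_add 2 (m + 1) j]
        push_cast
        field_simp
      calc _ ≤ ∑' _ : ZMod (2 ^ (m + 1 + j)), ENNReal.ofReal (c * min 1 (q m) ^ (M + 1)) := by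
            rw [tsum_fintype, Finset.sum_const, Finset.card_univ, ZMod.card, nsmul_eq_mul,
              ENNReal.ofReal_mul (by positivity)]
            gcongr
            rw [← ENNReal.ofReal_natCast]
            apply ENNReal.ofReal_le_ofReal
            push_cast
            exact pow_le_pow_right₀ one_le_two (by omega)
        _ ≤ _ := ENNReal.tsum_le_tsum h1
    refine top_le_iff.1 (le_trans (le_of_eq ?_) (ENNReal.tsum_le_tsum hterm))
    refine (tsum_ofReal_eq_top_of_div_le (c := c * min 1 (D ^ (M + 1) * c')) (by positivity) 1
      fun m => ?_).symm
    have hmpos : (0 : ℝ) < (m : ℝ) + ((1 : ℕ) : ℝ) + 1 := by positivity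
    rw [mul_left_comm, mul_div_assoc]
    gcongr
    -- If the mass bound exceeds 1, each crowding probability is bounded below and the number of
    -- cells alone gives divergence; otherwise the power `q ^ (M + 1)` is compared with the harmonic
    -- series.
    rcases le_total 1 (q m) with h | h
    · rw [min_eq_left h, one_pow, mul_one]
      have h1 : min 1 (D ^ (M + 1) * c') / ((m : ℝ) + (1 : ℕ) + 1) ≤ 1 := by
        rw [div_le_one hmpos]
        refine (min_le_left _ _).trans ?_
        have : (0 : ℝ) ≤ m := m.cast_nonneg
        push_cast
        linarith
      exact h1.trans (one_le_pow₀ one_le_two)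
    · rw [min_eq_right h]
      have h2 := hw (m + 1)
      simp only [hq]
      rw [← dyadicWeight_one, mul_pow, dyadicWeight_pow, mul_left_comm, dyadicWeight_mul,
        zero_add]
      calc _ ≤ D ^ (M + 1) * c' / ((m : ℝ) + (1 : ℕ) + 1) := by gcongr; exact min_le_right _ _
        _ = D ^ (M + 1) * (c' / (((m + 1 : ℕ) : ℝ) + 1)) := by push_cast; ring
        _ ≤ _ := by gcongr
  have h1 := measure_limsup_eq_one (fun i => hsm (e i)) hind hsum
  have h2 : ∀ᵐ ω ∂P, ω ∈ Filter.limsup (fun i => s (e i)) Filter.atTop :=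
    (mem_ae_iff_prob_eq_one (MeasurableSet.measurableSet_limsup fun i => hsm _)).2 h1
  filter_upwards [h2] with ω hω
  obtain ⟨i, hi⟩ := (Filter.mem_limsup_iff_frequently_mem.1 hω).exists
  exact ⟨(e i).1 + 1, by omega, (e i).2, hi⟩

lemma ae_not_isUnionOfSeparated (hΛ : IsPoissonProcess P (radialMeasure a b) Λ) {M : ℕ}
    (hab : 2 - 1 / ((M : ℝ) + 1) < a ∨ (a = 2 - 1 / ((M : ℝ) + 1) ∧ b ≤ 1 / ((M : ℝ) + 1))) :
    ∀ᵐ ω ∂P, ¬ IsUnionOfSeparated M fun k => Λ k ω := by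
  filter_upwards [ae_all_iff.2 (ae_exists_crowded_cell hΛ hab)] with ω hω
  rintro ⟨S, hS, hsep⟩
  choose δ hδ hsep using hsep
  have hlim : Filter.Tendsto (fun j : ℕ => 32 * ((2 : ℝ) ^ j)⁻¹) Filter.atTop (nhds 0) := by
    have := (tendsto_pow_atTop_nhds_zero_of_lt_one (r := (1 / 2 : ℝ)) (by norm_num)
      (by norm_num)).const_mul 32
    simpa using this
  -- There are finitely many classes, so one scale beats all their separation constants; M + 1
  -- points of a crowded cell then put two into one class.
  obtain ⟨j, hj⟩ := (Filter.eventually_all.2 fun i => hlim.eventually (gt_mem_nhds (hδ i))).exists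
  obtain ⟨m, hm, k, hk⟩ := hω j
  obtain ⟨t, ht, htc⟩ := Set.exists_subset_encard_eq hk
  have htf : t.Finite := Set.finite_of_encard_eq_coe htc
  have hcol : ∀ n, ∃ i, n ∈ S i := fun n => mem_iUnion.1 (hS ▸ mem_univ n)
  choose col hcol using hcol
  have hcard : (Finset.univ : Finset (Fin M)).card < htf.toFinset.card := by
    have h1 := htf.encard_eq_coe_toFinset_card
    rw [htc] at h1
    have h2 : M + 1 = htf.toFinset.card := by exact_mod_cast h1
    rw [Finset.card_univ, Fintype.card_fin]
    omega
  obtain ⟨x, hx, y, hy, hxy, hcxy⟩ := Finset.exists_ne_map_eq_of_card_lt_of_maps_to hcard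
    (f := col) fun _ _ => Finset.mem_univ _
  have hxS := hcol x
  have hyS := hcol y
  rw [← hcxy] at hyS
  have h1 := hsep (col x) ⟨x, hxS⟩ ⟨y, hyS⟩ (by simpa using hxy)
  have h2 := pseudoHyperbolicDist_le_of_mem_shellCell hm (ht (htf.mem_toFinset.1 hx))
    (ht (htf.mem_toFinset.1 hy))
  exact absurd (h1.trans h2) (not_le.2 (hj _))

lemma encard_mul_le_tsum_carlesonWindow {lam : ℕ → ℂ} {A : Set ℂ} {θ₀ h α : ℝ} {c : ENNReal}
    (hA : A ⊆ carlesonWindow θ₀ h) (hc : ∀ z ∈ A, c ≤ ENNReal.ofReal ((1 - ‖z‖) ^ α)) :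
    {k | lam k ∈ A}.encard * c ≤
      ∑' k : {k : ℕ // lam k ∈ carlesonWindow θ₀ h}, ENNReal.ofReal ((1 - ‖lam k‖) ^ α) := by
  rw [← ENNReal.tsum_set_const]
  calc _ ≤ ∑' k : {k | lam k ∈ A}, ENNReal.ofReal ((1 - ‖lam k‖) ^ α) :=
        ENNReal.tsum_le_tsum fun k => hc _ k.2
    _ ≤ _ := ENNReal.tsum_mono_subtype (fun k => ENNReal.ofReal ((1 - ‖lam k‖) ^ α))
        fun k hk => hA hk

lemma ae_not_isCarlesonSequence_one (hΛ : IsPoissonProcess P (radialMeasure a b) Λ)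
    (ha : 2 ≤ a) : ∀ᵐ ω ∂P, ¬ IsCarlesonSequence 1 fun k => Λ k ω := by
  -- For `2 ≤ a` the strict crowding condition holds for every M, and the single scale `j = 0` is
  -- enough.
  have hM : ∀ M : ℕ, _ := fun M => ae_exists_crowded_cell hΛ (M := M)
    (Or.inl (by have : (0 : ℝ) < 1 / ((M : ℝ) + 1) := by positivity
                linarith)) 0
  filter_upwards [ae_all_iff.2 hM] with ω hω
  rintro ⟨C, hC, h⟩
  -- Each point of the cell contributes at least a quarter of the window's length.
  obtain ⟨M, hMC⟩ := exists_nat_gt (4 * C)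
  obtain ⟨m, hm, k, hk⟩ := hω M
  have hm0 : (0 : ℝ) < ((2 : ℝ) ^ m)⁻¹ := by positivity
  have hsub : shellCell 0 m (2 ^ (m + 0)) k ⊆
      carlesonWindow (2 * Real.pi * (k.val : ℤ) / (2 ^ (m + 0) : ℕ)) ((2 : ℝ) ^ m)⁻¹ := by
    intro z hz
    have hz1 := norm_lt_one_of_mem_thinShell hz.1
    refine mem_carlesonWindow_of_sectorIndex_eq ?_ (by simp) ?_ hz1
    · rw [Int.cast_natCast, ZMod.natCast_zmod_val]; exact hz.2
    · have := (thinShell_bounds hz.1).2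
      have := one_sub_norm_le hz1.le
      linarith
  have hle := encard_mul_le_tsum_carlesonWindow (lam := fun k => Λ k ω) (α := 1)
    (c := ENNReal.ofReal (((2 : ℝ) ^ m)⁻¹ / 4)) hsub (fun z hz => by
      apply ENNReal.ofReal_le_ofReal
      have := (thinShell_bounds hz.1).1
      have := sub_sq_le_two_mul_one_sub_norm (norm_lt_one_of_mem_thinShell hz.1).le
      rw [Real.rpow_one]
      linarith)
  have h2 := hle.trans (h _ _ hm0 (inv_two_pow_le_one m))
  have h3 : ((M + 1 : ℕ) : ENNReal) ≤
      (({n | Λ n ω ∈ shellCell 0 m (2 ^ (m + 0)) k}.encard : ℕ∞) : ENNReal) := by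
    exact_mod_cast ENat.toENNReal_mono hk
  have h4 := (mul_le_mul_left h3 _).trans h2
  rw [← ENNReal.ofReal_natCast, ← ENNReal.ofReal_mul (by positivity), Real.rpow_one,
    ENNReal.ofReal_le_ofReal_iff (by positivity)] at h4
  push_cast at h4
  nlinarith

end RadialPoisson

lemma dyadicWeight_add_left (x : ℝ) (n l : ℕ) :
    dyadicWeight x 0 (n + l) = dyadicWeight x 0 n * dyadicWeight x 0 l := by
  unfold dyadicWeight
  rw [Real.rpow_zero, Real.rpow_zero, Real.rpow_zero, mul_one, mul_one, mul_one,
    ← Real.rpow_add two_pos]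
  push_cast
  ring_nf

lemma inv_two_pow_rpow (m : ℕ) (α : ℝ) : (((2 : ℝ) ^ m)⁻¹) ^ α = dyadicWeight (-α) 0 m := by
  unfold dyadicWeight
  rw [Real.rpow_zero, mul_one, Real.inv_rpow (by positivity), ← Real.rpow_natCast,
    ← Real.rpow_mul two_pos.le, ← Real.rpow_neg two_pos.le, mul_neg]

/-! ### The deterministic Carleson criterion -/

/-- A window of height h satisfies `1 - ‖z‖ ^ 2 < 2 * h`, hence the scale `2 * h`; the minimum with
1 gives `n = 0` when h is large. -/
lemma exists_dyadic_scale {h : ℝ} (h0 : 0 < h) :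
    ∃ n : ℕ, min (2 * h) 1 ≤ ((2 : ℝ) ^ n)⁻¹ ∧ ((2 : ℝ) ^ n)⁻¹ ≤ 4 * h := by
  have hx : 0 < min (2 * h) 1 := by positivity
  obtain ⟨n, h1, h2⟩ := exists_nat_pow_near (one_le_inv_iff₀.2 ⟨hx, min_le_right _ _⟩)
    (one_lt_two (α := ℝ))
  refine ⟨n, ?_, ?_⟩
  · rwa [le_inv_comm₀ hx (by positivity)]
  · rw [inv_lt_comm₀ hx (by positivity), pow_succ, mul_inv] at h2
    have := min_le_left (2 * h) 1
    linarith

lemma exists_mem_thinShell {n : ℕ} {z : ℂ} (hz : ‖z‖ < 1) (hn : 1 - ‖z‖ ^ 2 < ((2 : ℝ) ^ n)⁻¹) :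
    ∃ l, z ∈ thinShell 0 (n + l) := by
  have hs : 0 < 1 - ‖z‖ ^ 2 := by nlinarith [norm_nonneg z]
  have hex : ∃ l : ℕ, ((2 : ℝ) ^ (n + l))⁻¹ / 2 ≤ 1 - ‖z‖ ^ 2 := by
    obtain ⟨l, hl⟩ := exists_pow_lt_of_lt_one hs (y := (1 / 2 : ℝ)) (by norm_num)
    refine ⟨l, le_trans ?_ hl.le⟩
    rw [one_div, inv_pow]
    have h1 : ((2 : ℝ) ^ (n + l))⁻¹ ≤ ((2 : ℝ) ^ l)⁻¹ := by
      gcongr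
      · exact one_le_two
      · omega
    have h2 : (0 : ℝ) < ((2 : ℝ) ^ (n + l))⁻¹ := by positivity
    linarith
  classical
  refine ⟨Nat.find hex, ?_, ?_⟩
  · have := Nat.find_spec hex
    norm_num
    linarith
  · rcases h : Nat.find hex with _ | l
    · simpa using hn
    · have := Nat.find_min hex (m := l) (by omega)
      rw [← add_assoc, pow_succ (2 : ℝ), mul_inv]
      rw [not_le] at this
      linarith

/-- As `2 ^ n * h ≤ 1`, the arc is no longer than one sector and meets at most two consecutive ones.
-/
lemma carlesonWindow_subset {θ₀ h : ℝ} (h1 : h ≤ 1) {n : ℕ}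
    (hn : min (2 * h) 1 ≤ ((2 : ℝ) ^ n)⁻¹) :
    ∃ k : ZMod (2 ^ n), carlesonWindow θ₀ h ⊆
      ⋃ l, (shellCell 0 (n + l) (2 ^ n) k ∪ shellCell 0 (n + l) (2 ^ n) (k + 1)) := by
  set i : ℤ := ⌊((2 ^ n : ℕ) : ℝ) * (θ₀ / (2 * Real.pi))⌋ with hi
  refine ⟨i, ?_⟩
  rintro z ⟨r, ⟨hr1, hr2⟩, θ, ⟨hθ1, hθ2⟩, hz⟩
  have hr0 : 0 < r := by linarith
  have hpi := Real.pi_pos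
  have hN : (0 : ℝ) < ((2 ^ n : ℕ) : ℝ) := by positivity
  have hnorm : ‖z‖ = r := by
    rw [hz, norm_mul, Complex.norm_exp_ofReal_mul_I, Complex.norm_real, mul_one,
      Real.norm_of_nonneg hr0.le]
  have hs : 1 - ‖z‖ ^ 2 < min (2 * h) 1 := by
    rw [hnorm]
    exact lt_min (by nlinarith) (by nlinarith)
  obtain ⟨l, hl⟩ := exists_mem_thinShell (hnorm ▸ hr2) (hs.trans_le hn)
  have hsec := sectorIndex_polar (2 ^ n) hr0 θ
  rw [← hz] at hsec
  have hNh : ((2 ^ n : ℕ) : ℝ) * h ≤ 1 := by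
    have h2 : h ≤ ((2 : ℝ) ^ n)⁻¹ := le_trans (le_min (by linarith) h1) hn
    rw [le_inv_comm₀ (by linarith) (by positivity), inv_eq_one_div, le_div_iff₀ (by linarith)] at h2
    exact_mod_cast h2
  have ha : ((2 ^ n : ℕ) : ℝ) * (θ₀ / (2 * Real.pi)) ≤ (2 ^ n : ℕ) * (θ / (2 * Real.pi)) := by
    gcongr
  have hb : ((2 ^ n : ℕ) : ℝ) * (θ / (2 * Real.pi)) ≤
      (2 ^ n : ℕ) * (θ₀ / (2 * Real.pi)) + 1 := by
    calc ((2 ^ n : ℕ) : ℝ) * (θ / (2 * Real.pi)) ≤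
          (2 ^ n : ℕ) * ((θ₀ + 2 * Real.pi * h) / (2 * Real.pi)) := by gcongr
      _ = (2 ^ n : ℕ) * (θ₀ / (2 * Real.pi)) + (2 ^ n : ℕ) * h := by field_simp
      _ ≤ _ := by linarith
  have hf1 := Int.floor_le_floor ha
  have hf2 := Int.floor_le_floor hb
  rw [Int.floor_add_one] at hf2
  refine mem_iUnion.2 ⟨l, ?_⟩
  rcases (show ⌊((2 ^ n : ℕ) : ℝ) * (θ / (2 * Real.pi))⌋ = i ∨
    ⌊((2 ^ n : ℕ) : ℝ) * (θ / (2 * Real.pi))⌋ = i + 1 by omega) with h | h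
  · exact Or.inl ⟨hl, by rw [mem_ofPred_eq, hsec, h]⟩
  · exact Or.inr ⟨hl, by rw [mem_ofPred_eq, hsec, h, Int.cast_add, Int.cast_one]⟩

/-- A count bound depending only on the depth l below the top of a box makes the window sum at most
`2 * 2 ^ (-n α) * ∑ 2 ^ (-l α) * v l`, and `2 ^ (-n)` is comparable to the window's length. -/
lemma isCarlesonSequence_of_encard_le {lam : ℕ → ℂ} {α : ℝ} (hα : 0 < α) {v : ℕ → ℝ}
    (hv : ∀ l, 0 ≤ v l) (hsum : Summable fun l => dyadicWeight (-α) 0 l * v l)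
    (h : ∀ n l (k : ZMod (2 ^ n)),
      (({j | lam j ∈ shellCell 0 (n + l) (2 ^ n) k}.encard : ℕ∞) : ENNReal) ≤
        ENNReal.ofReal (v l)) :
    IsCarlesonSequence α lam := by
  have hnn : ∀ l, 0 ≤ dyadicWeight (-α) 0 l * v l :=
    fun l => mul_nonneg (dyadicWeight_pos _ _ _).le (hv l)
  set S := ∑' l, dyadicWeight (-α) 0 l * v l with hS
  have hS0 : 0 ≤ S := tsum_nonneg hnn
  -- The 2 counts sectors, `4 ^ α` comes from `2 ^ (-n) ≤ 4 * t`, and the added 1 makes the constant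
  -- positive.
  refine ⟨2 * S * 4 ^ α + 1, by positivity, fun θ₀ t t0 t1 => ?_⟩
  obtain ⟨n, hn1, hn2⟩ := exists_dyadic_scale t0
  obtain ⟨k, hk⟩ := carlesonWindow_subset (θ₀ := θ₀) t1 hn1
  set f : ℕ → ENNReal := fun j => ENNReal.ofReal ((1 - ‖lam j‖) ^ α) with hf
  have hcell : ∀ l (k : ZMod (2 ^ n)), ∑' j : {j | lam j ∈ shellCell 0 (n + l) (2 ^ n) k}, f j ≤
      ENNReal.ofReal (dyadicWeight (-α) 0 n * (dyadicWeight (-α) 0 l * v l)) := by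
    intro l k
    calc _ ≤ ∑' _ : {j | lam j ∈ shellCell 0 (n + l) (2 ^ n) k},
          ENNReal.ofReal (dyadicWeight (-α) 0 (n + l)) := by
          refine ENNReal.tsum_le_tsum fun j => ENNReal.ofReal_le_ofReal ?_
          have h1 := norm_lt_one_of_mem_thinShell j.2.1
          have h2 := (thinShell_bounds j.2.1).2
          have h3 := one_sub_norm_le h1.le
          rw [← inv_two_pow_rpow]
          exact Real.rpow_le_rpow (by linarith) (by linarith) hα.le
      _ = _ := ENNReal.tsum_set_const _ _
      _ ≤ ENNReal.ofReal (v l) * ENNReal.ofReal (dyadicWeight (-α) 0 (n + l)) := by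
          gcongr
          exact h n l k
      _ = _ := by
          rw [← ENNReal.ofReal_mul (hv l), dyadicWeight_add_left]
          ring_nf
  calc ∑' j : {j : ℕ // lam j ∈ carlesonWindow θ₀ t}, f j
      ≤ ∑' j : ↥(⋃ l, ({j | lam j ∈ shellCell 0 (n + l) (2 ^ n) k} ∪
          {j | lam j ∈ shellCell 0 (n + l) (2 ^ n) (k + 1)})), f j := by
        refine ENNReal.tsum_mono_subtype f fun j hj => ?_
        obtain ⟨l, hl⟩ := mem_iUnion.1 (hk hj)
        exact mem_iUnion.2 ⟨l, hl⟩
    _ ≤ ∑' l, 2 * ENNReal.ofReal (dyadicWeight (-α) 0 n * (dyadicWeight (-α) 0 l * v l)) := by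
        refine (ENNReal.tsum_iUnion_le_tsum f _).trans (ENNReal.tsum_le_tsum fun l => ?_)
        refine (ENNReal.tsum_union_le f _ _).trans ?_
        rw [two_mul]
        exact add_le_add (hcell l k) (hcell l (k + 1))
    _ = ENNReal.ofReal (2 * (dyadicWeight (-α) 0 n * S)) := by
        rw [ENNReal.tsum_mul_left, ← ENNReal.ofReal_tsum_of_nonneg
          (fun l => mul_nonneg (dyadicWeight_pos _ _ _).le (hnn l)) (hsum.mul_left _),
          tsum_mul_left, ENNReal.ofReal_mul zero_le_two, ENNReal.ofReal_ofNat]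
    _ ≤ _ := by
        apply ENNReal.ofReal_le_ofReal
        have h1 : dyadicWeight (-α) 0 n ≤ 4 ^ α * t ^ α := by
          rw [← inv_two_pow_rpow, ← Real.mul_rpow (by norm_num) t0.le]
          exact Real.rpow_le_rpow (by positivity) hn2 hα.le
        have h2 : 0 < t ^ α := by positivity
        calc _ ≤ 2 * (4 ^ α * t ^ α * S) := by gcongr
          _ ≤ _ := by nlinarith

/-! ### Almost sure α-Carleson conditions -/

section RadialPoisson

variable {Ω : Type*} [MeasurableSpace Ω] {P : Measure Ω} [IsProbabilityMeasure P] {a b : ℝ}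
  {Λ : ℕ → Ω → ℂ}

omit [IsProbabilityMeasure P] in
-- The test window is the one of length 1: by the first Borel–Cantelli lemma all but finitely many
-- shells carry a fixed fraction of `p m` points, and the resulting sum diverges.
lemma ae_not_isCarlesonSequence (hΛ : IsPoissonProcess P (radialMeasure a b) Λ) {α : ℝ}
    (hα : 0 < α) (hab : 1 + α < a ∨ (a = 1 + α ∧ b ≤ 1)) :
    ∀ᵐ ω ∂P, ¬ IsCarlesonSequence α fun k => Λ k ω := by
  obtain ⟨C, hC, hμ⟩ := exists_radialMeasure_shellCell_bounds a b
  set A : ℕ → Set ℂ := fun m => shellCell 0 m 1 0 with hA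
  set p : ℕ → ℝ := fun m => C⁻¹ * dyadicWeight (a - 1) (-b) m with hp
  have hp0 : ∀ m, 0 < p m := fun m => mul_pos (inv_pos.2 hC) (dyadicWeight_pos _ _ _)
  have hpA : ∀ m, p m ≤ (radialMeasure a b (A m)).toReal := by
    intro m
    have := (hμ 0 m 1 0).2.1
    simpa using this
  have ha : 1 < a := by rcases hab with h | ⟨h, -⟩ <;> linarith
  -- At the threshold `p / 4` the lower tail is at most `2 * exp (-p / 4)`; the crude bound `8 / p`
  -- is already summable because `1 < a`.
  have hlt : ∀ m, P {ω | pointCount Λ (A m) ω < (⌈p m / 4⌉₊ : ℕ)} ≤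
      ENNReal.ofReal (8 * C * dyadicWeight (-(a - 1)) b m) := by
    intro m
    refine (hΛ.measure_pointCount_lt_le (measurableSet_shellCell _ _ _ _) (hμ 0 m 1 0).1 _).trans
      (ENNReal.ofReal_le_ofReal ?_)
    have h1 : (2 : ℝ) ^ ⌈p m / 4⌉₊ ≤ 2 * Real.exp (p m / 4) := by
      have h2 : (2 : ℝ) ^ (p m / 4) ≤ Real.exp (p m / 4) := by
        rw [Real.rpow_def_of_pos two_pos]
        gcongr
        have := Real.log_two_lt_d9
        nlinarith [hp0 m]
      calc (2 : ℝ) ^ ⌈p m / 4⌉₊ = (2 : ℝ) ^ ((⌈p m / 4⌉₊ : ℕ) : ℝ) := (Real.rpow_natCast _ _).symm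
        _ ≤ (2 : ℝ) ^ (p m / 4 + 1) := by
            gcongr
            · exact one_le_two
            · exact (Nat.ceil_lt_add_one (by have := hp0 m; positivity)).le
        _ = 2 * (2 : ℝ) ^ (p m / 4) := by rw [Real.rpow_add two_pos, Real.rpow_one, mul_comm]
        _ ≤ _ := by gcongr
    calc _ ≤ 2 * Real.exp (p m / 4) * Real.exp (-p m / 2) := by
          gcongr
          exact hpA m
      _ = 2 * (Real.exp (p m / 4))⁻¹ := by
          rw [mul_assoc, ← Real.exp_add, ← Real.exp_neg]
          ring_nf
      _ ≤ 2 * (p m / 4)⁻¹ := by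
          have h3 := hp0 m
          have h4 := Real.add_one_le_exp (p m / 4)
          gcongr
          linarith
      _ = _ := by
          have h5 : dyadicWeight (-(a - 1)) b m = (dyadicWeight (a - 1) (-b) m)⁻¹ := by
            rw [dyadicWeight_inv, neg_neg]
          have h6 := dyadicWeight_pos (a - 1) (-b) m
          rw [h5, hp]
          field_simp
          norm_num
  have hev := ae_eventually_notMem (μ := P)
    (s := fun m => {ω | pointCount Λ (A m) ω < (⌈p m / 4⌉₊ : ℕ)}) (by
      refine ne_top_of_le_ne_top ?_ (ENNReal.tsum_le_tsum hlt)
      exact ((summable_dyadicWeight_of_neg (by linarith) b).mul_left (8 * C)).tsum_ofReal_ne_top)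
  filter_upwards [hev] with ω hω
  rintro ⟨B, hB, hcarl⟩
  obtain ⟨m₀, hm₀⟩ := Filter.eventually_atTop.1 hω
  have hwin : ∀ m, A m ⊆ carlesonWindow 0 1 := by
    intro m z hz
    have h1 := norm_lt_one_of_mem_thinShell hz.1
    have h2 := (thinShell_bounds hz.1).2
    have h3 := inv_two_pow_le_one m
    have := mem_carlesonWindow_of_sectorIndex_eq (N := 1) (i := 0) (h := 1) (z := z)
      (Subsingleton.elim _ _) (by simp) (by nlinarith [norm_nonneg z]) h1
    simpa using this
  set f : ℕ → ENNReal := fun j => ENNReal.ofReal ((1 - ‖Λ j ω‖) ^ α) with hf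
  have hle : ∑' m, ∑' j : {j | Λ j ω ∈ A (m + m₀)}, f j ≤
      ∑' j : {j : ℕ // Λ j ω ∈ carlesonWindow 0 1}, f j := by
    rw [← ENNReal.tsum_sigma' (fun x : Σ m, {j | Λ j ω ∈ A (m + m₀)} => f x.2)]
    refine ENNReal.tsum_comp_le_tsum_of_injective
      (f := fun x : (Σ m, {j | Λ j ω ∈ A (m + m₀)}) =>
        (⟨x.2, hwin _ x.2.2⟩ : {j : ℕ // Λ j ω ∈ carlesonWindow 0 1})) ?_
        (fun j : {j : ℕ // Λ j ω ∈ carlesonWindow 0 1} => f j)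
    rintro ⟨m, j, hj⟩ ⟨m', j', hj'⟩ h
    have h1 : j = j' := congrArg Subtype.val h
    subst h1
    have h2 : m = m' := by
      by_contra hne
      exact (Set.disjoint_left.1 (disjoint_thinShell (j := 0) ((add_left_injective m₀).ne hne)))
        hj.1 hj'.1
    subst h2
    rfl
  obtain ⟨c, hc, hw⟩ := exists_div_le_dyadicWeight (x := -α + (a - 1)) (y := 0 + -b) (by
    rcases hab with h | ⟨h, h'⟩
    · left; linarith
    · right; constructor <;> linarith)
  have hterm : ∀ m, ENNReal.ofReal
      ((4 ^ α)⁻¹ * C⁻¹ / 4 * dyadicWeight (-α + (a - 1)) (0 + -b) (m + m₀)) ≤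
        ∑' j : {j | Λ j ω ∈ A (m + m₀)}, f j := by
    intro m
    have h1 := not_lt.1 (hm₀ (m + m₀) (Nat.le_add_left _ _))
    calc _ = ENNReal.ofReal (p (m + m₀) / 4) *
          ENNReal.ofReal ((4 ^ α)⁻¹ * dyadicWeight (-α) 0 (m + m₀)) := by
          rw [← ENNReal.ofReal_mul (by have := hp0 (m + m₀); positivity), ← dyadicWeight_mul]
          simp only [hp]
          ring_nf
      _ ≤ ((pointCount Λ (A (m + m₀)) ω : ℕ∞) : ENNReal) *
          ENNReal.ofReal ((4 ^ α)⁻¹ * dyadicWeight (-α) 0 (m + m₀)) := by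
          gcongr
          calc _ ≤ ENNReal.ofReal ((⌈p (m + m₀) / 4⌉₊ : ℕ) : ℝ) :=
                ENNReal.ofReal_le_ofReal (Nat.le_ceil _)
            _ = (((⌈p (m + m₀) / 4⌉₊ : ℕ) : ℕ∞) : ENNReal) := by
                rw [ENNReal.ofReal_natCast]; rfl
            _ ≤ _ := ENat.toENNReal_mono h1
      _ = _ := (ENNReal.tsum_set_const _ _).symm
      _ ≤ _ := by
          refine ENNReal.tsum_le_tsum fun j => ENNReal.ofReal_le_ofReal ?_
          have h2 := sub_sq_le_two_mul_one_sub_norm (norm_lt_one_of_mem_thinShell j.2.1).le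
          have h3 := (thinShell_bounds j.2.1).1
          rw [← inv_two_pow_rpow, ← Real.inv_rpow (by norm_num),
            ← Real.mul_rpow (by norm_num) (by positivity)]
          exact Real.rpow_le_rpow (by positivity) (by linarith) hα.le
  have htop : ∑' m, ENNReal.ofReal
      ((4 ^ α)⁻¹ * C⁻¹ / 4 * dyadicWeight (-α + (a - 1)) (0 + -b) (m + m₀)) = ⊤ := by
    refine tsum_ofReal_eq_top_of_div_le (c := (4 ^ α)⁻¹ * C⁻¹ / 4 * c) (by positivity) m₀
      fun m => ?_
    have := hw (m + m₀)
    push_cast at this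
    rw [mul_div_assoc]
    gcongr
  have := (ENNReal.tsum_le_tsum hterm).trans (hle.trans (hcarl 0 1 one_pos le_rfl))
  rw [htop, top_le_iff] at this
  exact ENNReal.ofReal_ne_top this

/-- The estimate `j ^ j / j ! ≤ exp j` makes the tail exponentially small in j once the threshold is
a large multiple of the mean. -/
lemma pow_div_factorial_le_pow {p q : ℝ} {j : ℕ} (hp : 0 ≤ p) (hpq : p ≤ q * j) :
    p ^ j / j ! ≤ (Real.exp 1 * q) ^ j := by
  rcases Nat.eq_zero_or_pos j with rfl | hj
  · simp
  have hj' : (0 : ℝ) < j := Nat.cast_pos.2 hj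
  have hq : 0 ≤ q := by
    by_contra h
    nlinarith
  calc p ^ j / j ! ≤ (q * j) ^ j / j ! := by gcongr
    _ = q ^ j * ((j : ℝ) ^ j / j !) := by rw [mul_pow]; ring
    _ ≤ q ^ j * Real.exp j := by
        gcongr
        exact Real.pow_div_factorial_le_exp _ hj'.le _
    _ = _ := by rw [mul_pow, mul_comm, ← Real.exp_nat_mul, mul_one]

/-- The event that some box exceeds K times the profile `v` has probability `O(1 / K)`: the decay `2
^ (-γ n)` of the means, raised to the power K, outweighs the `2 ^ n` sectors. Almost surely one K
therefore works for all boxes. -/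
lemma ae_isCarlesonSequence_of_bound (hΛ : IsPoissonProcess P (radialMeasure a b) Λ)
    {α x y γ C : ℝ} (hα : 0 < α) (hx : 0 < x) (hγ : 0 < γ) (hC : 0 < C)
    (hsum : Summable (dyadicWeight (-α + x) (0 + y)))
    (hμ : ∀ n l (k : ZMod (2 ^ n)), (radialMeasure a b (shellCell 0 (n + l) (2 ^ n) k)).toReal ≤
      C * (dyadicWeight (-γ) 0 n * dyadicWeight x y l)) :
    ∀ᵐ ω ∂P, IsCarlesonSequence α fun k => Λ k ω := by
  obtain ⟨_, -, hfin⟩ := exists_radialMeasure_shellCell_bounds a b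
  -- Giving up one power of `l + 1` ensures `v l ≥ l + 1`, so the tail exponent grows at least
  -- linearly in l and the sum over depths is geometric.
  obtain ⟨c, hc, hcw⟩ := exists_le_dyadicWeight hx (y - 1)
  set v : ℕ → ℝ := fun l => c⁻¹ * dyadicWeight x y l with hv
  have hv0 : ∀ l, 0 < v l := fun l => mul_pos (inv_pos.2 hc) (dyadicWeight_pos _ _ _)
  have hv1 : ∀ l : ℕ, (l : ℝ) + 1 ≤ v l := by
    intro l
    have h1 : dyadicWeight x y l = dyadicWeight x (y - 1) l * ((l : ℝ) + 1) := by
      have : ((l : ℝ) + 1) = dyadicWeight 0 1 l := by simp [dyadicWeight]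
      rw [this, dyadicWeight_mul]
      ring_nf
    rw [hv]
    simp only
    rw [h1, ← mul_assoc]
    have h2 : 1 ≤ c⁻¹ * dyadicWeight x (y - 1) l := by
      rw [inv_mul_eq_div, one_le_div hc]
      exact hcw l
    have h3 : (0 : ℝ) < (l : ℝ) + 1 := by positivity
    nlinarith
  obtain ⟨D, hD⟩ : ∃ D, D = C * c := ⟨_, rfl⟩
  have hD0 : 0 < D := by rw [hD]; positivity
  have hμ' : ∀ n l (k : ZMod (2 ^ n)),
      (radialMeasure a b (shellCell 0 (n + l) (2 ^ n) k)).toReal ≤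
        D * dyadicWeight (-γ) 0 n * v l := by
    intro n l k
    refine (hμ n l k).trans (le_of_eq ?_)
    simp only [hv, hD]
    field_simp
  set bad : ℕ → Set Ω := fun K => ⋃ n, ⋃ l, ⋃ k : ZMod (2 ^ n),
    {ω | ((⌈K * v l⌉₊ : ℕ) : ℕ∞) ≤ pointCount Λ (shellCell 0 (n + l) (2 ^ n) k) ω} with hbad
  -- `2 / γ ≤ K` turns `2 ^ (-γ n K)` into at most `4 ^ (-n)`; `2 * e * D ≤ K` makes the ratio `e *
  -- D / K` at most 1/2.
  have hcell : ∀ K : ℕ, 1 ≤ K → 2 / γ ≤ K → 2 * (Real.exp 1 * D) ≤ K →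
      ∀ n l (k : ZMod (2 ^ n)),
      P {ω | ((⌈K * v l⌉₊ : ℕ) : ℕ∞) ≤ pointCount Λ (shellCell 0 (n + l) (2 ^ n) k) ω} ≤
        ENNReal.ofReal (((4 : ℝ) ^ n)⁻¹ * (Real.exp 1 * D / K * (1 / 2) ^ l)) := by
    intro K hK1 hK2 hK3 n l k
    refine (hΛ.measure_le_pointCount_le (measurableSet_shellCell _ _ _ _) (hfin _ _ _ k).1 _).trans
      (ENNReal.ofReal_le_ofReal ?_)
    have hK0 : (0 : ℝ) < K := Nat.cast_pos.2 hK1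
    set j := ⌈K * v l⌉₊ with hj
    set t := dyadicWeight (-γ) 0 n with ht
    have ht0 : 0 < t := dyadicWeight_pos _ _ _
    have htK : t ^ K ≤ ((4 : ℝ) ^ n)⁻¹ := by
      rw [ht, dyadicWeight_pow, show ((4 : ℝ) ^ n) = ((2 : ℝ) ^ n) ^ 2 by
        rw [← pow_mul, mul_comm, pow_mul]; norm_num, ← dyadicWeight_natCast, dyadicWeight_inv]
      unfold dyadicWeight
      rw [div_le_iff₀ hγ] at hK2
      simp only [mul_zero, neg_zero, Real.rpow_zero, mul_one]
      apply Real.rpow_le_rpow_of_exponent_le one_le_two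
      push_cast
      have : (0 : ℝ) ≤ n := n.cast_nonneg
      nlinarith
    have ht1 : t ≤ 1 := by
      rw [ht]
      unfold dyadicWeight
      rw [Real.rpow_zero, mul_one]
      apply Real.rpow_le_one_of_one_le_of_nonpos one_le_two
      have : (0 : ℝ) ≤ n := n.cast_nonneg
      nlinarith
    have hjv : K * v l ≤ j := Nat.le_ceil _
    have hjK : K * (l + 1) ≤ j := by
      have h1 : (K : ℝ) * (l + 1) ≤ j := le_trans (by gcongr; exact hv1 l) hjv
      exact_mod_cast h1
    obtain ⟨q, hq⟩ : ∃ q, q = Real.exp 1 * D / K := ⟨_, rfl⟩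
    have hq0 : 0 < q := by rw [hq]; positivity
    have hq1 : q ≤ 1 / 2 := by
      rw [hq, div_le_iff₀ hK0]
      linarith
    calc _ ≤ (Real.exp 1 * (D * t / K)) ^ j := by
          refine pow_div_factorial_le_pow ENNReal.toReal_nonneg ((hμ' n l k).trans ?_)
          calc D * t * v l = D * t / K * (K * v l) := by field_simp
            _ ≤ _ := by gcongr
      _ = (t * q) ^ j := by rw [hq]; ring
      _ ≤ (t * q) ^ (K * (l + 1)) :=
          pow_le_pow_of_le_one (by positivity) (by nlinarith) hjK
      _ = t ^ (K * (l + 1)) * q ^ (K * (l + 1)) := mul_pow _ _ _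
      _ ≤ t ^ K * q ^ (l + 1) := by
          gcongr ?_ * ?_
          · exact pow_le_pow_of_le_one ht0.le ht1 (Nat.le_mul_of_pos_right _ (by omega))
          · exact pow_le_pow_of_le_one hq0.le (by linarith) (Nat.le_mul_of_pos_left _ (by omega))
      _ ≤ _ := by
          rw [pow_succ', hq]
          rw [hq] at hq1 hq0
          gcongr
  have hbadK : ∀ K : ℕ, 1 ≤ K → 2 / γ ≤ K → 2 * (Real.exp 1 * D) ≤ K →
      P (bad K) ≤ ENNReal.ofReal (4 * (Real.exp 1 * D) / K) := by
    intro K hK1 hK2 hK3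
    have hK0 : (0 : ℝ) < K := Nat.cast_pos.2 hK1
    have hgeo : ∀ x : ℝ, 0 ≤ x →
        ∑' n : ℕ, ENNReal.ofReal (x * (1 / 2) ^ n) = ENNReal.ofReal (x * 2) := by
      intro x hx
      rw [← ENNReal.ofReal_tsum_of_nonneg (fun n => by positivity)
        (summable_geometric_two.mul_left x), tsum_mul_left, tsum_geometric_two]
    calc P (bad K) ≤ ∑' n : ℕ, ∑' l : ℕ, ∑' k : ZMod (2 ^ n),
          ENNReal.ofReal (((4 : ℝ) ^ n)⁻¹ * (Real.exp 1 * D / K * (1 / 2) ^ l)) := by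
          refine (measure_iUnion_le _).trans (ENNReal.tsum_le_tsum fun n => ?_)
          refine (measure_iUnion_le _).trans (ENNReal.tsum_le_tsum fun l => ?_)
          refine (measure_iUnion_le _).trans (ENNReal.tsum_le_tsum fun k => ?_)
          exact hcell K hK1 hK2 hK3 n l k
      _ = ∑' n : ℕ, ∑' l : ℕ,
          ENNReal.ofReal ((1 / 2) ^ n * (Real.exp 1 * D / K) * (1 / 2) ^ l) := by
          refine tsum_congr fun n => tsum_congr fun l => ?_
          rw [tsum_fintype, Finset.sum_const, Finset.card_univ, ZMod.card, nsmul_eq_mul,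
            ← ENNReal.ofReal_natCast, ← ENNReal.ofReal_mul (by positivity)]
          congr 1
          rw [show ((4 : ℝ) ^ n) = (2 : ℝ) ^ n * (2 : ℝ) ^ n by rw [← mul_pow]; norm_num]
          push_cast
          rw [one_div, inv_pow]
          field_simp
          rw [← mul_pow]
          norm_num
      _ = ∑' n : ℕ, ENNReal.ofReal ((Real.exp 1 * D / K * 2) * (1 / 2) ^ n) := by
          refine tsum_congr fun n => ?_
          rw [hgeo _ (by positivity)]
          ring_nf
      _ = _ := by
          rw [hgeo _ (by positivity)]
          ring_nf
  have hnull : P (⋂ K, bad K) = 0 := by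
    have hlim : Filter.Tendsto (fun K : ℕ => ENNReal.ofReal (4 * (Real.exp 1 * D) / K))
        Filter.atTop (nhds 0) := by
      rw [← ENNReal.ofReal_zero]
      exact ENNReal.tendsto_ofReal (tendsto_const_div_atTop_nhds_zero_nat _)
    refine le_antisymm (ge_of_tendsto hlim ?_) zero_le
    filter_upwards [Filter.eventually_ge_atTop 1,
      tendsto_natCast_atTop_atTop.eventually_ge_atTop (2 / γ),
      tendsto_natCast_atTop_atTop.eventually_ge_atTop (2 * (Real.exp 1 * D))] with K h1 h2 h3
    exact (measure_mono (iInter_subset _ K)).trans (hbadK K h1 h2 h3)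
  have hae : ∀ᵐ ω ∂P, ω ∉ ⋂ K, bad K := measure_eq_zero_iff_ae_notMem.1 hnull
  filter_upwards [hae] with ω hω
  simp only [hbad, mem_iInter, mem_iUnion, not_forall, not_exists, mem_ofPred_eq, not_le] at hω
  obtain ⟨K, hK⟩ := hω
  refine isCarlesonSequence_of_encard_le (v := fun l => K * v l) hα
    (fun l => mul_nonneg K.cast_nonneg (hv0 l).le) ?_ fun n l k => ?_
  · refine (hsum.mul_left (K * c⁻¹)).congr fun l => ?_
    rw [← dyadicWeight_mul]
    simp only [hv]
    ring
  · have h1 := hK n l k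
    obtain ⟨N, hN⟩ := ENat.ne_top_iff_exists.1 h1.ne_top
    have h2 : {j | Λ j ω ∈ shellCell 0 (n + l) (2 ^ n) k}.encard = N := hN.symm
    rw [← hN] at h1
    have h3 : N < ⌈K * v l⌉₊ := by exact_mod_cast h1
    rw [h2]
    have h4 : (N : ℝ) ≤ K * v l := (Nat.lt_ceil.1 h3).le
    calc (((N : ℕ) : ℕ∞) : ENNReal) = ENNReal.ofReal (N : ℝ) := by
          rw [ENNReal.ofReal_natCast]; rfl
      _ ≤ _ := ENNReal.ofReal_le_ofReal h4

lemma ae_isCarlesonSequence_of_lt (hΛ : IsPoissonProcess P (radialMeasure a b) Λ) {α : ℝ}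
    (hα : 0 < α) (hα1 : α ≤ 1) (ha1 : 1 ≤ a) (ha : a < 1 + α) :
    ∀ᵐ ω ∂P, IsCarlesonSequence α fun k => Λ k ω := by
  obtain ⟨C, hC, hμ⟩ := exists_radialMeasure_shellCell_bounds a b
  -- Half of the gap absorbs the logarithmic factor and makes `a - 1 + ε` positive even for `a = 1`;
  -- the other half leaves the summable exponent `-ε`. Also `2 - a - ε > 0`.
  obtain ⟨ε, hε⟩ : ∃ ε, ε = (1 + α - a) / 2 := ⟨_, rfl⟩
  have hε0 : 0 < ε := by rw [hε]; linarith
  obtain ⟨B, hB, hBw⟩ := exists_dyadicWeight_le (neg_lt_zero.2 hε0) (-b)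
  refine ae_isCarlesonSequence_of_bound hΛ (x := a - 1 + ε) (y := 0) (γ := 2 - a - ε)
    (C := C * B) hα (by linarith) (by linarith) (by positivity)
    (summable_dyadicWeight_of_neg (by linarith) _) fun n l k => ?_
  refine (hμ 0 (n + l) (2 ^ n) k).2.2.trans ?_
  have h1 : dyadicWeight (a - 1) (-b) (n + l) ≤
      B * (dyadicWeight (a - 1 + ε) 0 n * dyadicWeight (a - 1 + ε) 0 l) := by
    rw [← dyadicWeight_add_left]
    have h2 : dyadicWeight (a - 1) (-b) (n + l) =
        dyadicWeight (-ε) (-b) (n + l) * dyadicWeight (a - 1 + ε) 0 (n + l) := by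
      rw [dyadicWeight_mul]; ring_nf
    rw [h2]
    have := dyadicWeight_pos (a - 1 + ε) 0 (n + l)
    gcongr
    exact hBw _
  have h3 : dyadicWeight (-(2 - a - ε)) 0 n = dyadicWeight (a - 1 + ε) 0 n / 2 ^ n := by
    rw [div_eq_mul_inv, ← dyadicWeight_neg_one, dyadicWeight_mul]
    ring_nf
  rw [h3, Nat.cast_pow, Nat.cast_ofNat]
  calc _ ≤ C * (B * (dyadicWeight (a - 1 + ε) 0 n * dyadicWeight (a - 1 + ε) 0 l)) / 2 ^ n := by
        gcongr
    _ = _ := by ring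

/-- On the boundary the powers of two cancel and `∑ (l + 1) ^ (-b)` remains. The decay rate in n is
`1 - α`, which vanishes for `α = 1`. -/
lemma ae_isCarlesonSequence_of_eq {α : ℝ} (hΛ : IsPoissonProcess P (radialMeasure (1 + α) b) Λ)
    (hα : 0 < α) (hα1 : α < 1) (hb : 1 < b) :
    ∀ᵐ ω ∂P, IsCarlesonSequence α fun k => Λ k ω := by
  obtain ⟨C, hC, hμ⟩ := exists_radialMeasure_shellCell_bounds (1 + α) b
  refine ae_isCarlesonSequence_of_bound hΛ (x := α) (y := -b) (γ := 1 - α)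
    (C := C) hα hα (by linarith) hC ?_ fun n l k => ?_
  · rw [neg_add_cancel, zero_add]
    exact summable_dyadicWeight_zero (by linarith)
  refine (hμ 0 (n + l) (2 ^ n) k).2.2.trans ?_
  rw [add_sub_cancel_left]
  have h1 : dyadicWeight α (-b) (n + l) ≤ dyadicWeight α 0 n * dyadicWeight α (-b) l := by
    have h2 : ∀ m, dyadicWeight α (-b) m = dyadicWeight α 0 m * ((m : ℝ) + 1) ^ (-b) := fun m => by
      simp [dyadicWeight]
    rw [h2, h2, dyadicWeight_add_left, ← mul_assoc]
    have h3 := dyadicWeight_pos α 0 n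
    have h4 := dyadicWeight_pos α 0 l
    gcongr ?_ * ?_
    apply Real.rpow_le_rpow_of_nonpos (by positivity) _ (by linarith)
    push_cast
    have : (0 : ℝ) ≤ n := n.cast_nonneg
    linarith
  have h3 : dyadicWeight (-(1 - α)) 0 n = dyadicWeight α 0 n / 2 ^ n := by
    rw [div_eq_mul_inv, ← dyadicWeight_neg_one, dyadicWeight_mul]
    ring_nf
  rw [h3, Nat.cast_pow, Nat.cast_ofNat]
  calc _ ≤ C * (dyadicWeight α 0 n * dyadicWeight α (-b) l) / 2 ^ n := by gcongr
    _ = _ := by ring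

end RadialPoisson

/-! ### Greedy colouring -/

/-- The count of neighbours includes k itself, so at most M - 1 earlier indices conflict with k and
one of the M colours is free. -/
lemma exists_greedy_colouring {r : ℕ → ℕ → Prop} {M : ℕ} (hr : ∀ k, r k k)
    (h : ∀ k, {l | r l k}.encard ≤ M) :
    ∃ col : ℕ → Fin M, ∀ k, ∀ l < k, r l k → col l ≠ col k := by
  have hex : ∀ k (f : ∀ l, l < k → Fin M), ∃ c, ∀ l (hl : l < k), r l k → f l hl ≠ c := by
    intro k f
    by_contra! hcon
    choose l hl hlr hlf using hcon
    have hinj : Function.Injective l := by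
      intro c c' hcc
      rw [← hlf c, ← hlf c']
      congr
    have h1 : (insert k (range l)).encard = (M + 1 : ℕ) := by
      rw [encard_insert_of_notMem, ← image_univ, hinj.encard_image, encard_univ]
      · simp
      · rintro ⟨c, hc⟩
        exact (hl c).ne hc
    have h2 : insert k (range l) ⊆ {l | r l k} := by
      rintro _ (rfl | ⟨c, rfl⟩)
      exacts [hr _, hlr c]
    have h3 := (encard_le_encard h2).trans (h k)
    rw [h1] at h3
    have : M + 1 ≤ M := by exact_mod_cast h3
    omega
  choose g hg using hex
  refine ⟨wellFounded_lt.fix g, fun k l hl hrl => ?_⟩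
  rw [wellFounded_lt.fix_eq g k]
  exact hg k (fun y _ => wellFounded_lt.fix g y) l hl hrl

lemma pseudoHyperbolicDist_comm (z w : ℂ) :
    pseudoHyperbolicDist z w = pseudoHyperbolicDist w z := by
  unfold pseudoHyperbolicDist
  rw [norm_div, norm_div, norm_sub_rev z w, ← RCLike.norm_conj (1 - (starRingEnd ℂ) w * z)]
  simp only [map_sub, map_one, map_mul, Complex.conj_conj, mul_comm]

/-- From `1 - conj z * w = (1 - ‖z‖ ^ 2) - conj z * (w - z)` one gets `‖w - z‖ ≤ δ * (1 - ‖z‖ ^ 2 +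
‖w - z‖)`, and `δ ≤ 1 / 2` absorbs the last term. -/
lemma norm_sub_le_of_pseudoHyperbolicDist_lt {z w : ℂ} (hz : ‖z‖ < 1) (hw : ‖w‖ < 1) {δ : ℝ}
    (hδ : δ ≤ 1 / 2) (h : pseudoHyperbolicDist w z < δ) : ‖w - z‖ ≤ 2 * δ * (1 - ‖z‖ ^ 2) := by
  have hδ0 : 0 < δ := lt_of_le_of_lt (norm_nonneg _) h
  have hden : 0 < ‖1 - (starRingEnd ℂ) z * w‖ := by
    have := norm_sub_norm_le (1 : ℂ) ((starRingEnd ℂ) z * w)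
    rw [norm_one, norm_mul, RCLike.norm_conj] at this
    nlinarith [norm_nonneg z, norm_nonneg w]
  have h1 : ‖1 - (starRingEnd ℂ) z * w‖ ≤ (1 - ‖z‖ ^ 2) + ‖w - z‖ := by
    have : 1 - (starRingEnd ℂ) z * w =
        ((1 - ‖z‖ ^ 2 : ℝ) : ℂ) - (starRingEnd ℂ) z * (w - z) := by
      have := Complex.conj_mul' z
      push_cast
      rw [← this]
      ring
    rw [this]
    refine (norm_sub_le _ _).trans ?_
    rw [norm_mul, RCLike.norm_conj, Complex.norm_real, Real.norm_of_nonneg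
      (by nlinarith [norm_nonneg z])]
    have := norm_nonneg (w - z)
    nlinarith
  unfold pseudoHyperbolicDist at h
  rw [norm_div, div_lt_iff₀ hden] at h
  have := norm_nonneg (w - z)
  nlinarith

/-! ### The overlapping grid -/

/-- The square, in the grid of mesh `1 / N`, which contains `z`. -/
noncomputable def gridIndex (N : ℝ) (z : ℂ) : ℤ × ℤ := (⌊N * z.re⌋, ⌊N * z.im⌋)

lemma measurable_gridIndex (N : ℝ) : Measurable (gridIndex N) :=
  (Int.measurable_floor.comp (Complex.measurable_re.const_mul N)).prodMk
    (Int.measurable_floor.comp (Complex.measurable_im.const_mul N))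

/-- The block of nine squares around a given one. -/
def gridBlock (N : ℝ) (c : ℤ × ℤ) : Set ℂ := {z | gridIndex N z - c ∈ Finset.Icc (-1 : ℤ × ℤ) 1}

lemma measurableSet_gridBlock (N : ℝ) (c : ℤ × ℤ) : MeasurableSet (gridBlock N c) :=
  measurable_gridIndex N
    (MeasurableSet.of_discrete (s := {x : ℤ × ℤ | x - c ∈ Finset.Icc (-1 : ℤ × ℤ) 1}))

lemma abs_floor_sub_floor_le_one {x y : ℝ} (h : |x - y| ≤ 1) : -1 ≤ ⌊x⌋ - ⌊y⌋ ∧ ⌊x⌋ - ⌊y⌋ ≤ 1 := by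
  rw [abs_le] at h
  have h1 := Int.floor_le_floor (show x ≤ y + 1 by linarith)
  have h2 := Int.floor_le_floor (show y ≤ x + 1 by linarith)
  rw [Int.floor_add_one] at h1 h2
  omega

lemma mem_gridBlock_of_norm_sub_le {N : ℝ} (hN : 0 < N) {z w : ℂ} (h : ‖w - z‖ ≤ 1 / N) :
    w ∈ gridBlock N (gridIndex N z) := by
  have h1 := (Complex.abs_re_le_norm (w - z)).trans h
  have h2 := (Complex.abs_im_le_norm (w - z)).trans h
  have h3 : ∀ x y : ℝ, |x - y| ≤ 1 / N → |N * x - N * y| ≤ 1 := fun x y hxy => by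
    rw [← mul_sub, abs_mul, abs_of_pos hN, mul_comm]
    rwa [le_div_iff₀ hN] at hxy
  have h4 := abs_floor_sub_floor_le_one (h3 _ _ h1)
  have h5 := abs_floor_sub_floor_le_one (h3 _ _ h2)
  change gridIndex N w - gridIndex N z ∈ Finset.Icc (-1 : ℤ × ℤ) 1
  rw [Finset.mem_Icc, Prod.le_def, Prod.le_def]
  exact ⟨⟨h4.1, h5.1⟩, ⟨h4.2, h5.2⟩⟩

lemma normalizedVolume_gridBlock_le {N : ℝ} (hN : 0 < N) (c : ℤ × ℤ) :
    normalizedVolume (gridBlock N c) ≤ ENNReal.ofReal (9 / N ^ 2) := by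
  have hsub : gridBlock N c ⊆ Metric.closedBall
      (⟨(c.1 + 1 / 2) / N, (c.2 + 1 / 2) / N⟩ : ℂ) (3 / N) := by
    intro z hz
    change gridIndex N z - c ∈ Finset.Icc (-1 : ℤ × ℤ) 1 at hz
    rw [Finset.mem_Icc, Prod.le_def, Prod.le_def] at hz
    obtain ⟨⟨h1, h2⟩, h3, h4⟩ := hz
    have key : ∀ (x : ℝ) (k : ℤ), -1 ≤ ⌊N * x⌋ - k → ⌊N * x⌋ - k ≤ 1 →
        |x - (k + 1 / 2) / N| ≤ (3 / 2) / N := by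
      intro x k hk1 hk2
      have e1 : ((-1 : ℤ) : ℝ) ≤ ((⌊N * x⌋ - k : ℤ) : ℝ) := by exact_mod_cast hk1
      have e2 : ((⌊N * x⌋ - k : ℤ) : ℝ) ≤ ((1 : ℤ) : ℝ) := by exact_mod_cast hk2
      push_cast at e1 e2
      have e3 := Int.floor_le (N * x)
      have e4 := Int.lt_floor_add_one (N * x)
      have e5 : x - (k + 1 / 2) / N = (N * x - (k + 1 / 2)) / N := by field_simp
      rw [e5, abs_div, abs_of_pos hN]
      gcongr
      rw [abs_le]
      constructor <;> linarith
    have a1 := key z.re c.1 h1 h3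
    have a2 := key z.im c.2 h2 h4
    rw [Metric.mem_closedBall, dist_eq_norm]
    refine (Complex.norm_le_abs_re_add_abs_im _).trans ?_
    rw [Complex.sub_re, Complex.sub_im]
    calc _ ≤ 3 / 2 / N + 3 / 2 / N := add_le_add a1 a2
      _ = _ := by ring
  refine (measure_mono hsub).trans (le_of_eq ?_)
  rw [normalizedVolume_closedBall (by positivity), div_pow]
  norm_num

/-- Every point lies in nine blocks. Bounding the total mass this way avoids counting the blocks
that meet `W`. -/
lemma tsum_measure_inter_gridBlock_le (μ : Measure ℂ) (W : Set ℂ) (N : ℝ) :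
    ∑' c, μ (W ∩ gridBlock N c) ≤ 9 * μ W := by
  set ν : Measure (ℤ × ℤ) := (μ.restrict W).map (gridIndex N) with hν
  have hνu : ν univ = μ W := by
    rw [hν, Measure.map_apply (measurable_gridIndex N) MeasurableSet.univ, preimage_univ,
      Measure.restrict_apply_univ]
  have h1 : ∀ c, μ (W ∩ gridBlock N c) ≤ ∑ e ∈ Finset.Icc (-1 : ℤ × ℤ) 1, ν {e + c} := by
    intro c
    have h2 : W ∩ gridBlock N c ⊆
        ⋃ e ∈ Finset.Icc (-1 : ℤ × ℤ) 1, W ∩ gridIndex N ⁻¹' {e + c} := by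
      rintro z ⟨hz, hz'⟩
      simp only [mem_iUnion]
      exact ⟨_, hz', hz, by simp⟩
    refine (measure_mono h2).trans ((measure_biUnion_finset_le _ _).trans
      (Finset.sum_le_sum fun e _ => ?_))
    rw [hν, Measure.map_apply (measurable_gridIndex N) (measurableSet_singleton _),
      Measure.restrict_apply (measurable_gridIndex N (measurableSet_singleton _)), inter_comm]
  calc _ ≤ ∑' c, ∑ e ∈ Finset.Icc (-1 : ℤ × ℤ) 1, ν {e + c} := ENNReal.tsum_le_tsum h1
    _ = ∑ e ∈ Finset.Icc (-1 : ℤ × ℤ) 1, ∑' c, ν {e + c} :=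
        Summable.tsum_finsetSum fun _ _ => ENNReal.summable
    _ = ∑ e ∈ Finset.Icc (-1 : ℤ × ℤ) 1, ν univ := by
        refine Finset.sum_congr rfl fun e _ => ?_
        have h3 := (Equiv.addLeft e).tsum_eq (fun c => ν {c})
        simp only [Equiv.coe_addLeft] at h3
        rw [h3, ← Measure.tsum_indicator_apply_singleton ν univ MeasurableSet.univ]
        simp
    _ = _ := by
        rw [Finset.sum_const, hνu, nsmul_eq_mul]
        rfl

/-- The outer parameter of the widened shell with `m = 0` is 2, so `t ≤ 1` cannot be assumed. -/
lemma normalizedVolume_diskShell_le {s t : ℝ} (hst : s ≤ t) (hs : s ≤ 1) :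
    normalizedVolume (diskShell s t) ≤ ENNReal.ofReal (t - s) := by
  rcases le_total t 1 with ht | ht
  · exact (normalizedVolume_diskShell hst ht).le
  · have hsub : diskShell s t ⊆ Metric.closedBall 0 (Real.sqrt (1 - s)) := fun z hz => by
      rw [mem_closedBall_zero_iff, Real.le_sqrt (norm_nonneg _) (by linarith)]
      linarith [hz.1]
    refine (measure_mono hsub).trans ?_
    rw [normalizedVolume_closedBall (by positivity), Real.sq_sqrt (by linarith)]
    exact ENNReal.ofReal_le_ofReal (by linarith)

/-- A dyadic shell with its neighbours. -/
def wideShell (m : ℕ) : Set ℂ := diskShell (((2 : ℝ) ^ m)⁻¹ / 4) (2 * ((2 : ℝ) ^ m)⁻¹)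

/-- The part in the `m`-th wide shell of a block of squares of side `2 ^ (-(m + j))`. -/
def gridCell (j m : ℕ) (c : ℤ × ℤ) : Set ℂ := wideShell m ∩ gridBlock (2 ^ (m + j)) c

lemma measurableSet_gridCell (j m : ℕ) (c : ℤ × ℤ) : MeasurableSet (gridCell j m c) :=
  (measurableSet_diskShell _ _).inter (measurableSet_gridBlock _ _)

/-- A pseudo-hyperbolic disk of small radius lies in one cell. -/
lemma exists_gridCell {j : ℕ} (hj : 3 ≤ j) {z : ℂ} (hz : ‖z‖ < 1) :
    ∃ m c, ∀ w, ‖w‖ < 1 → pseudoHyperbolicDist w z < ((2 : ℝ) ^ j)⁻¹ / 2 → w ∈ gridCell j m c := by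
  have hs : 0 < 1 - ‖z‖ ^ 2 := by nlinarith [norm_nonneg z]
  obtain ⟨m, hm1, hm2⟩ := exists_nat_pow_near_of_lt_one hs (by nlinarith [norm_nonneg z])
    (show (0 : ℝ) < 1 / 2 by norm_num) (by norm_num)
  rw [pow_succ] at hm1
  rw [one_div, inv_pow] at hm1 hm2
  have hj1 : ((2 : ℝ) ^ j)⁻¹ ≤ 1 / 8 := by
    rw [one_div]
    gcongr
    calc (8 : ℝ) = 2 ^ 3 := by norm_num
      _ ≤ _ := pow_le_pow_right₀ one_le_two hj
  have hj0 : (0 : ℝ) < ((2 : ℝ) ^ j)⁻¹ := by positivity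
  have hm0 : (0 : ℝ) < ((2 : ℝ) ^ m)⁻¹ := by positivity
  refine ⟨m, gridIndex (2 ^ (m + j)) z, fun w hw h => ?_⟩
  have h1 := norm_sub_le_of_pseudoHyperbolicDist_lt hz hw (by linarith) h
  have h2 : ‖w - z‖ ≤ ((2 : ℝ) ^ j)⁻¹ * ((2 : ℝ) ^ m)⁻¹ := by
    refine h1.trans ?_
    rw [mul_div_cancel₀ _ two_ne_zero]
    gcongr
  have h3 : |‖w‖ - ‖z‖| ≤ ‖w - z‖ := abs_norm_sub_norm_le w z
  -- Here `3 ≤ j` enters: `1 - ‖w‖ ^ 2` differs from `1 - ‖z‖ ^ 2` by at most `2 ^ (-m) / 4`, which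
  -- the wide shell tolerates.
  have h4 : ‖w - z‖ ≤ ((2 : ℝ) ^ m)⁻¹ / 8 := h2.trans (by nlinarith)
  rw [abs_le] at h3
  refine ⟨⟨?_, ?_⟩, mem_gridBlock_of_norm_sub_le (by positivity) (h2.trans (le_of_eq ?_))⟩
  · nlinarith [norm_nonneg z, norm_nonneg w]
  · nlinarith [norm_nonneg z, norm_nonneg w]
  · rw [pow_add, one_div, mul_inv, mul_comm]

lemma isUnionOfSeparated_of_encard_le {lam : ℕ → ℂ} (hlam : ∀ k, ‖lam k‖ < 1) {M j : ℕ}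
    (hj : 3 ≤ j) (h : ∀ m c, {k | lam k ∈ gridCell j m c}.encard ≤ M) :
    IsUnionOfSeparated M lam := by
  have hδ : (0 : ℝ) < ((2 : ℝ) ^ j)⁻¹ / 2 := by positivity
  obtain ⟨col, hcol⟩ := exists_greedy_colouring
    (r := fun l k => pseudoHyperbolicDist (lam l) (lam k) < ((2 : ℝ) ^ j)⁻¹ / 2) (M := M)
    (fun k => by simp [pseudoHyperbolicDist]) fun k => by
      obtain ⟨m, c, hmc⟩ := exists_gridCell hj (hlam k)
      exact (encard_le_encard (t := {l | lam l ∈ gridCell j m c}) fun l hl => hmc _ (hlam l) hl).trans (h m c)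
  refine ⟨fun i => {k | col k = i}, ?_, fun i => ⟨_, hδ, ?_⟩⟩
  · ext k; simp
  · rintro ⟨k, hk⟩ ⟨l, hl⟩ hne
    have hkl : k ≠ l := fun h => hne (Subtype.ext h)
    by_contra hlt
    rw [not_le] at hlt
    have heq : col k = col l := hk.trans hl.symm
    rcases lt_or_gt_of_ne hkl with h' | h'
    · exact hcol l k h' hlt heq
    · exact hcol k l h' (by rwa [pseudoHyperbolicDist_comm]) heq.symm

/-! ### Almost sure decomposition into separated sequences -/

section RadialPoisson

variable {Ω : Type*} [MeasurableSpace Ω] {P : Measure Ω} [IsProbabilityMeasure P] {a b : ℝ}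
  {Λ : ℕ → Ω → ℂ}

/-- In the bound `p ^ (M + 1)` for a cell of mass p, M factors are estimated by the largest cell
mass and the last is summed over cells to the shell mass. The product is the summable weight times a
power of `4 ^ (-j)`. -/
lemma exists_measure_crowded_gridCell_le (hΛ : IsPoissonProcess P (radialMeasure a b) Λ) {M : ℕ}
    (hM : 1 ≤ M) (hsum : Summable (dyadicWeight (1 + (M + 1) * (a - 2)) ((M + 1) * -b))) :
    ∃ B : ℝ, 0 ≤ B ∧ ∀ j, P (⋃ m, ⋃ c,
      {ω | ((M + 1 : ℕ) : ℕ∞) ≤ pointCount Λ (gridCell j m c) ω}) ≤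
        ENNReal.ofReal (B * (1 / 4) ^ j) := by
  obtain ⟨C, hC, hμ⟩ := exists_radialMeasure_bounds a b
  set S := ∑' m, dyadicWeight (1 + (M + 1) * (a - 2)) ((M + 1) * -b) m with hS
  have hS0 : 0 ≤ S := tsum_nonneg fun m => (dyadicWeight_pos _ _ _).le
  set D : ℝ := (C * 9) ^ M * (9 * (C * 2)) with hD
  have hD0 : 0 < D := by positivity
  refine ⟨D * S, by positivity, fun j => ?_⟩
  have hcell : ∀ m c, radialMeasure a b (gridCell j m c) ≤
      ENNReal.ofReal (C * 9 * (1 / 4) ^ j * dyadicWeight (a - 2) (-b) m) := by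
    intro m c
    refine ((hμ m _ (measurableSet_gridCell j m c) inter_subset_left).2.trans
      (mul_le_mul_right ((measure_mono inter_subset_right).trans
        (normalizedVolume_gridBlock_le (by positivity) c)) _)).trans (le_of_eq ?_)
    have hw := dyadicWeight_pos a (-b) m
    rw [← ENNReal.ofReal_mul (by positivity)]
    have h1 : dyadicWeight (a - 2) (-b) m = dyadicWeight a (-b) m * (((2 : ℝ) ^ m) ^ 2)⁻¹ := by
      rw [← dyadicWeight_natCast, dyadicWeight_inv, dyadicWeight_mul]
      push_cast
      ring_nf
    have h2 : ((1 : ℝ) / 4) ^ j = (((2 : ℝ) ^ j) ^ 2)⁻¹ := by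
      rw [← pow_mul, mul_comm, pow_mul, ← inv_pow]; norm_num
    rw [h1, h2, pow_add]
    congr 1
    field_simp
  have hwide : ∀ m, radialMeasure a b (wideShell m) ≤
      ENNReal.ofReal (C * 2 * dyadicWeight (a - 1) (-b) m) := by
    intro m
    have hm0 : (0 : ℝ) < ((2 : ℝ) ^ m)⁻¹ := by positivity
    have hm1 := inv_two_pow_le_one m
    refine ((hμ m _ (measurableSet_diskShell _ _) subset_rfl).2.trans
      (mul_le_mul_right (normalizedVolume_diskShell_le (by linarith) (by linarith)) _)).trans ?_
    have hw := dyadicWeight_pos a (-b) m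
    rw [← ENNReal.ofReal_mul (by positivity)]
    apply ENNReal.ofReal_le_ofReal
    have h1 : dyadicWeight (a - 1) (-b) m = dyadicWeight a (-b) m * ((2 : ℝ) ^ m)⁻¹ := by
      rw [← dyadicWeight_neg_one, dyadicWeight_mul]
      ring_nf
    rw [h1]
    calc _ ≤ C * dyadicWeight a (-b) m * (2 * ((2 : ℝ) ^ m)⁻¹) := by gcongr; linarith
      _ = _ := by ring
  have htail : ∀ m c, P {ω | ((M + 1 : ℕ) : ℕ∞) ≤ pointCount Λ (gridCell j m c) ω} ≤
      ENNReal.ofReal (C * 9 * (1 / 4) ^ j * dyadicWeight (a - 2) (-b) m) ^ M *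
        radialMeasure a b (gridCell j m c) := by
    intro m c
    have hfin := ne_top_of_le_ne_top ENNReal.ofReal_ne_top (hcell m c)
    refine (hΛ.measure_le_pointCount_le (measurableSet_gridCell j m c) hfin _).trans ?_
    calc _ ≤ ENNReal.ofReal ((radialMeasure a b (gridCell j m c)).toReal ^ (M + 1)) := by
          apply ENNReal.ofReal_le_ofReal
          refine div_le_self (by positivity) ?_
          exact_mod_cast Nat.one_le_iff_ne_zero.2 (Nat.factorial_ne_zero _)
      _ = radialMeasure a b (gridCell j m c) ^ M * radialMeasure a b (gridCell j m c) := by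
          rw [ENNReal.ofReal_pow ENNReal.toReal_nonneg, ENNReal.ofReal_toReal hfin, pow_succ]
      _ ≤ _ := by
          gcongr
          exact hcell m c
  -- `1 ≤ M` leaves at least one factor that is small in j.
  have hj4 : (((1 : ℝ) / 4) ^ j) ^ M ≤ (1 / 4) ^ j :=
    pow_le_of_le_one (by positivity) (pow_le_one₀ (by norm_num) (by norm_num)) (by omega)
  calc _ ≤ ∑' m, ∑' c, P {ω | ((M + 1 : ℕ) : ℕ∞) ≤ pointCount Λ (gridCell j m c) ω} :=
        (measure_iUnion_le _).trans (ENNReal.tsum_le_tsum fun m => measure_iUnion_le _)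
    _ ≤ ∑' m, ENNReal.ofReal (C * 9 * (1 / 4) ^ j * dyadicWeight (a - 2) (-b) m) ^ M *
          (9 * ENNReal.ofReal (C * 2 * dyadicWeight (a - 1) (-b) m)) := by
        refine ENNReal.tsum_le_tsum fun m => (ENNReal.tsum_le_tsum (htail m)).trans ?_
        rw [ENNReal.tsum_mul_left]
        gcongr
        refine (tsum_measure_inter_gridBlock_le _ _ _).trans ?_
        gcongr
        exact hwide m
    _ ≤ ∑' m, ENNReal.ofReal (D * (1 / 4) ^ j *
          dyadicWeight (1 + (M + 1) * (a - 2)) ((M + 1) * -b) m) := by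
        refine ENNReal.tsum_le_tsum fun m => ?_
        have hw1 := dyadicWeight_pos (a - 2) (-b) m
        have hw2 := dyadicWeight_pos (a - 1) (-b) m
        have hw3 := dyadicWeight_pos (1 + (M + 1) * (a - 2)) ((M + 1) * -b) m
        rw [← ENNReal.ofReal_pow (by positivity), ← ENNReal.ofReal_ofNat 9,
          ← ENNReal.ofReal_mul (by norm_num), ← ENNReal.ofReal_mul (by positivity)]
        apply ENNReal.ofReal_le_ofReal
        have h1 : dyadicWeight (1 + (M + 1) * (a - 2)) ((M + 1) * -b) m =
            dyadicWeight (a - 2) (-b) m ^ M * dyadicWeight (a - 1) (-b) m := by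
          rw [dyadicWeight_pow, dyadicWeight_mul]
          ring_nf
        calc _ = D * (((1 : ℝ) / 4) ^ j) ^ M *
              (dyadicWeight (a - 2) (-b) m ^ M * dyadicWeight (a - 1) (-b) m) := by
              rw [hD, mul_pow, mul_pow]
              ring
          _ ≤ _ := by
              rw [← h1]
              gcongr
    _ = _ := by
        rw [← ENNReal.ofReal_tsum_of_nonneg
          (fun m => mul_nonneg (by positivity) (dyadicWeight_pos _ _ _).le) (hsum.mul_left _),
          tsum_mul_left, ← hS]
        ring_nf

lemma ae_isUnionOfSeparated (hΛ : IsPoissonProcess P (radialMeasure a b) Λ) {M : ℕ} (hM : 1 ≤ M)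
    (hsum : Summable (dyadicWeight (1 + (M + 1) * (a - 2)) ((M + 1) * -b))) :
    ∀ᵐ ω ∂P, IsUnionOfSeparated M fun k => Λ k ω := by
  obtain ⟨B, hB, hP⟩ := exists_measure_crowded_gridCell_le hΛ hM hsum
  set bad : ℕ → Set Ω := fun j => ⋃ m, ⋃ c,
    {ω | ((M + 1 : ℕ) : ℕ∞) ≤ pointCount Λ (gridCell j m c) ω} with hbad
  -- The shift by 3 keeps the scale within the range required by the covering of pseudo-hyperbolic
  -- disks.
  have hnull : P (⋂ j, bad (j + 3)) = 0 := by
    have hlim : Filter.Tendsto (fun j : ℕ => ENNReal.ofReal (B * (1 / 4) ^ (j + 3)))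
        Filter.atTop (nhds 0) := by
      have h1 := ((tendsto_pow_atTop_nhds_zero_of_lt_one (r := (1 / 4 : ℝ)) (by norm_num)
        (by norm_num)).const_mul B).comp (Filter.tendsto_add_atTop_nat 3)
      have h2 := ENNReal.tendsto_ofReal h1
      rw [mul_zero, ENNReal.ofReal_zero] at h2
      exact h2
    refine le_antisymm (ge_of_tendsto' hlim fun j => ?_) zero_le
    exact (measure_mono (iInter_subset _ j)).trans (hP (j + 3))
  have hae : ∀ᵐ ω ∂P, ω ∉ ⋂ j, bad (j + 3) := measure_eq_zero_iff_ae_notMem.1 hnull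
  filter_upwards [hae] with ω hω
  simp only [hbad, mem_iInter, mem_iUnion, not_forall, not_exists, mem_ofPred_eq, not_le] at hω
  obtain ⟨j, hj⟩ := hω
  refine isUnionOfSeparated_of_encard_le (j := j + 3)
    (fun k => mem_ball_zero_iff.1 (hΛ.mem_disk k ω)) (by omega) fun m c => ?_
  have h1 := hj m c
  rw [Nat.cast_add, Nat.cast_one] at h1
  exact Order.lt_add_one_iff_of_not_isMax (by simp) |>.1 h1

lemma ae_isUnionOfSeparated_iff (hΛ : IsPoissonProcess P (radialMeasure a b) Λ) {M : ℕ}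
    (hM : 1 ≤ M) : (∀ᵐ ω ∂P, IsUnionOfSeparated M fun k => Λ k ω) ↔
      (a < 2 - 1 / ((M : ℝ) + 1) ∨ (a = 2 - 1 / ((M : ℝ) + 1) ∧ 1 / ((M : ℝ) + 1) < b)) := by
  have hM0 : (0 : ℝ) < (M : ℝ) + 1 := by positivity
  constructor
  · intro h
    by_contra hcon
    rw [not_or, not_lt, not_and, not_lt] at hcon
    obtain ⟨ω, h1, h2⟩ := (h.and (ae_not_isUnionOfSeparated hΛ (M := M) (by
      rcases hcon.1.lt_or_eq with h' | h'
      · exact Or.inl h'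
      · exact Or.inr ⟨h'.symm, hcon.2 h'.symm⟩))).exists
    exact h2 h1
  · rintro (h | ⟨rfl, h⟩)
    · refine ae_isUnionOfSeparated hΛ hM (summable_dyadicWeight_of_neg ?_ _)
      rw [lt_sub_comm, div_lt_iff₀ hM0] at h
      linarith
    · refine ae_isUnionOfSeparated hΛ hM ?_
      have h1 : 1 + ((M : ℝ) + 1) * (2 - 1 / ((M : ℝ) + 1) - 2) = 0 := by field_simp; ring
      rw [h1]
      apply summable_dyadicWeight_zero
      rw [div_lt_iff₀ hM0] at h
      linarith

end RadialPoisson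

/-! ### The case M = 1 and assembly of the theorem -/

lemma isUnionOfSeparated_one_iff (lam : ℕ → ℂ) :
    IsUnionOfSeparated 1 lam ↔ IsSeparatedFamily lam := by
  constructor
  · rintro ⟨S, hS, hsep⟩
    have hmem : ∀ k, k ∈ S 0 := fun k => by
      obtain ⟨i, hi⟩ := mem_iUnion.1 (hS ▸ mem_univ k)
      rwa [Subsingleton.elim 0 i]
    obtain ⟨δ, hδ, h⟩ := hsep 0
    exact ⟨δ, hδ, fun k l hkl => h ⟨k, hmem k⟩ ⟨l, hmem l⟩ (by simpa using hkl)⟩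
  · rintro ⟨δ, hδ, h⟩
    exact ⟨fun _ => univ, iUnion_const _, fun _ =>
      ⟨δ, hδ, fun k l hkl => h k l fun h' => hkl (Subtype.ext h')⟩⟩

theorem mainTheorem7 {Ω : Type*} [MeasurableSpace Ω] (P : Measure Ω) [IsProbabilityMeasure P]
    (a b : ℝ) (hab : 1 < a ∨ (a = 1 ∧ b ≤ 1)) (Λ : ℕ → Ω → ℂ)
    (hΛ : IsPoissonProcess P (radialMeasure a b) Λ) :
    (∀ M : ℕ, 1 ≤ M →
      ((∀ᵐ ω ∂P, IsUnionOfSeparated M (fun k => Λ k ω)) ↔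
        (a < 2 - 1 / ((M : ℝ) + 1) ∨
          (a = 2 - 1 / ((M : ℝ) + 1) ∧ 1 / ((M : ℝ) + 1) < b)))) ∧
    ((∀ᵐ ω ∂P, IsSeparatedFamily (fun k => Λ k ω)) ↔
      (a < 3 / 2 ∨ (a = 3 / 2 ∧ 1 / 2 < b))) ∧
    ((∀ᵐ ω ∂P, IsCarlesonSequence 1 (fun k => Λ k ω)) ↔ a < 2) ∧
    (∀ α : ℝ, 0 < α → α < 1 →
      ((∀ᵐ ω ∂P, IsCarlesonSequence α (fun k => Λ k ω)) ↔
        (a < 1 + α ∨ (a = 1 + α ∧ 1 < b)))) := by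
  have ha : 1 ≤ a := by rcases hab with h | ⟨h, -⟩ <;> linarith
  refine ⟨fun M hM => ae_isUnionOfSeparated_iff hΛ hM, ?_, ?_, fun α hα hα1 => ?_⟩
  · have h := ae_isUnionOfSeparated_iff hΛ le_rfl
    simp only [isUnionOfSeparated_one_iff] at h
    rw [h]
    norm_num
  · constructor
    · intro h
      by_contra hcon
      obtain ⟨ω, h1, h2⟩ := (h.and (ae_not_isCarlesonSequence_one hΛ (not_lt.1 hcon))).exists
      exact h2 h1
    · intro h
      exact ae_isCarlesonSequence_of_lt hΛ one_pos le_rfl ha (by linarith)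
  · constructor
    · intro h
      by_contra hcon
      rw [not_or, not_lt, not_and, not_lt] at hcon
      obtain ⟨ω, h1, h2⟩ := (h.and (ae_not_isCarlesonSequence hΛ hα (by
        rcases hcon.1.lt_or_eq with h' | h'
        · exact Or.inl h'
        · exact Or.inr ⟨h'.symm, hcon.2 h'.symm⟩))).exists
      exact h2 h1
    · rintro (h | ⟨rfl, h⟩)
      · exact ae_isCarlesonSequence_of_lt hΛ hα hα1.le ha h
      · exact ae_isCarlesonSequence_of_eq hΛ hα hα1 h
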